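/- Let $n\ge 0$ and let $\Gamma(\mathbb C^n)$ be the $n$-mode boson Fock space with its particle basis $\{|\mathbf t\rangle:\mathbf t\in\mathbb Z_+^n\}$ (occupation number representation, $\Gamma(\mathbb C^n)=\ell^2(\mathbb Z_+^n)$). Write $|e(\mathbf z)\rangle=\sum_{\mathbf k}\frac{\mathbf z^{\mathbf k}}{\sqrt{\mathbf k!}}|\mathbf k\rangle$ for the exponential vectors, $|\psi(\mathbf z)\rangle=e^{-\|\mathbf z\|^2/2}|e(\mathbf z)\rangle$ for the coherent states, and $W(\mathbf u)$ for the Weyl operator determined by $W(\mathbf u)|\psi(\mathbf z)\rangle=e^{-i\,\mathrm{Im}\langle \mathbf u|\mathbf z\rangle}|\psi(\mathbf u+\mathbf z)\rangle$ (inner products are linear in the second variable). A positive bounded operator $Z$ on $\Gamma(\mathbb C^n)$ has $\mathcal E_2$-parameters $(c,\boldsymbol\alpha,A,\Lambda)$, where $A$ is complex symmetric, if for all $\mathbf u,\mathbf v\in\mathbb C^n$ $$\langle e(\bar{\mathbf u})|Z|e(\mathbf v)\rangle=c\exp\{\mathbf u^T\boldsymbol\alpha+\bar{\boldsymbol\alpha}^T\mathbf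 v+\mathbf u^TA\mathbf u+\mathbf u^T\Lambda\mathbf v+\mathbf v^T\bar A\mathbf v\}.$$ A state (positive operator of unit trace) $\rho$ is gaussian with mean $\mathbf m\in\mathbb C^n$ if there is a real symmetric $2n\times 2n$ matrix $S$ with $\operatorname{tr}\rho W(\mathbf z)=\exp\{-2i\,\mathrm{Im}\langle\mathbf z|\mathbf m\rangle-[\mathbf x^T\ \mathbf y^T]S\begin{bmatrix}\mathbf x\\ \mathbf y\end{bmatrix}\}$ for all $\mathbf z=\mathbf x+i\mathbf y$. A unit vector $\psi$ is called a mean zero pure gaussian state if $|\psi\rangle\langle\psi|$ is gaussian with mean $0$. For an $n\times n$ upper triangular matrix $R=[r_{ij}]$ with entries in $\mathbb Z_+$ put $\tilde r_i=\sum_{j\le i}r_{ji}+\sum_{j\ge i}r_{ij}$, $|R|=\sum_{i,j}r_{ij}$, $R!=\prod_{i,j}r_{ij}!$; for $\mathbf t\in\mathbb Z_+^n$ let $\Delta(\mathbf t)$ be the finite set of those $R$ with $(\tilde r_1,\dots,\tilde r_n)=\mathbf t$. For $A=[a_{ij}]\in M_n(\mathbb C)$ define $$\varphi_A(\mathbf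 t)=\sqrt{\mathbf t!}\sum_{R\in\Delta(\mathbf t)}2^{|R|-\operatorname{tr}R}\,\frac{\prod_{i,j}a_{ij}^{r_{ij}}}{R!}.$$ Put $$M(A,0)=I-2\begin{bmatrix}\mathrm{Re}A&\mathrm{Im}A\\ \mathrm{Im}A&-\mathrm{Re}A\end{bmatrix},\qquad c(A,0)=\sqrt{\det M(A,0)}\ \text{ when } M(A,0)\ge 0 .$$ **Proposition.** Let $c>0$ and let $A$ be a complex symmetric $n\times n$ matrix. Then $(c,0,A,0)$ are the $\mathcal E_2$-parameters of a positive bounded operator $Z$ on $\Gamma(\mathbb C^n)$ if and only if $$\sum_{\mathbf t\in\mathbb Z_+^n}|\varphi_A(\mathbf t)|^2<\infty .$$ In this case: (i) $Z=|\psi\rangle\langle\psi|$, where $|\psi\rangle=\sqrt c\,\sum_{\mathbf t}\varphi_A(\mathbf t)|\mathbf t\rangle$ (a convergent series in $\Gamma(\mathbb C^n)$); (ii) $M(A,0)\ge 0$, so $c(A,0)$ is defined, and the vector $$|\psi_A\rangle=\sqrt{c(A,0)}\sum_{\mathbf t\in\mathbb Z_+^n}\varphi_A(\mathbf t)|\mathbf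 t\rangle$$ is a mean zero pure gaussian state; $|\psi_A\rangle\langle\psi_A|$ has $\mathcal E_2$-parameters $(c(A,0),0,A,0)$. -/

import Mathlib

open scoped Matrix InnerProductSpace ComplexConjugate

noncomputable section

namespace BosonFock

/-! ### The n-mode boson Fock space, particle basis, exponential vectors -/

/-- The boson Fock space `Γ(ℂⁿ)` of `n` modes in the occupation number representation: the Hilbert
space `ℓ²(ℤ₊ⁿ)`, whose canonical orthonormal basis is the particle basis `|k⟩ = |k₁, …, kₙ⟩`. -/
abbrev Fock (n : ℕ) : Type := lp (fun _ : Fin n → ℕ => ℂ) 2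

variable {n : ℕ}

/-- The particle basis vector `|k⟩`. -/
def ket (k : Fin n → ℕ) : Fock n := lp.single 2 k 1

/-- `z ^ k = z₁ ^ k₁ ⋯ zₙ ^ kₙ`. -/
def multiPow (z : Fin n → ℂ) (k : Fin n → ℕ) : ℂ := ∏ i, z i ^ k i

/-- `k! = k₁! ⋯ kₙ!`. -/
def multiFactorial (k : Fin n → ℕ) : ℕ := ∏ i, (k i).factorial

theorem hasSum_pi_prod : ∀ {n : ℕ} (f : Fin n → ℕ → ℂ), (∀ i, Summable fun m => ‖f i m‖) →
    (Summable fun k : Fin n → ℕ => ‖∏ i, f i (k i)‖) ∧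
      HasSum (fun k : Fin n → ℕ => ∏ i, f i (k i)) (∏ i, ∑' m, f i m) := by
  intro n
  induction n with
  | zero =>
    intro f _
    refine ⟨(hasSum_fintype _).summable, ?_⟩
    simp
  | succ n ih =>
    intro f hf
    obtain ⟨h1, h2⟩ := ih (fun i => f i.succ) (fun i => hf i.succ)
    have hs := (hf 0).mul_norm h1
    constructor
    · rw [← (Fin.consEquiv (fun _ : Fin (n + 1) => ℕ)).summable_iff]
      refine hs.congr fun p => ?_
      simp [Fin.prod_univ_succ, Fin.consEquiv]
    · rw [← (Fin.consEquiv (fun _ : Fin (n + 1) => ℕ)).hasSum_iff, Fin.prod_univ_succ]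
      have := (hf 0).of_norm.hasSum.mul h2 hs.of_norm
      refine this.congr_fun ?_
      intro p
      simp [Fin.prod_univ_succ, Fin.consEquiv]

/-- The coefficients `z ^ k / √(k!)` of the exponential vector are multiplied as expected. -/
theorem hasSum_expCoeff_mul (u z : Fin n → ℂ) :
    (Summable fun k => ‖(conj (multiPow u k / (√(multiFactorial k : ℝ) : ℂ))) *
        (multiPow z k / (√(multiFactorial k : ℝ) : ℂ))‖) ∧
      HasSum (fun k => (conj (multiPow u k / (√(multiFactorial k : ℝ) : ℂ))) *
        (multiPow z k / (√(multiFactorial k : ℝ) : ℂ))) (Complex.exp (star u ⬝ᵥ z)) := by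
  have key : ∀ k : Fin n → ℕ, (conj (multiPow u k / (√(multiFactorial k : ℝ) : ℂ))) *
      (multiPow z k / (√(multiFactorial k : ℝ) : ℂ)) =
      ∏ i, (conj (u i) * z i) ^ k i / ((k i).factorial : ℂ) := by
    intro k
    have h0 : (0 : ℝ) ≤ (multiFactorial k : ℝ) := Nat.cast_nonneg _
    have h1 : ((√(multiFactorial k : ℝ) : ℂ)) * (√(multiFactorial k : ℝ) : ℂ) =
        ∏ i, ((k i).factorial : ℂ) := by
      rw [← Complex.ofReal_mul, Real.mul_self_sqrt h0]
      simp [multiFactorial]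
    rw [map_div₀, Complex.conj_ofReal, div_mul_div_comm, h1, Finset.prod_div_distrib]
    simp [multiPow, Finset.prod_mul_distrib, mul_pow, map_prod]
  have hs := hasSum_pi_prod (fun (i : Fin n) m => (conj (u i) * z i) ^ m / (m.factorial : ℂ))
    (fun i => NormedSpace.norm_expSeries_div_summable (conj (u i) * z i))
  simp only [key]
  refine ⟨hs.1, ?_⟩
  have h2 : ∏ i, ∑' m : ℕ, (conj (u i) * z i) ^ m / (m.factorial : ℂ) =
      Complex.exp (star u ⬝ᵥ z) := by
    simp only [dotProduct, Complex.exp_sum, Pi.star_apply, RCLike.star_def]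
    refine Finset.prod_congr rfl fun i _ => ?_
    rw [Complex.exp_eq_exp_ℂ, NormedSpace.exp_eq_tsum_div]
  rw [← h2]
  exact hs.2

theorem memℓp_expCoeff (z : Fin n → ℂ) :
    Memℓp (fun k : Fin n → ℕ => multiPow z k / (√(multiFactorial k : ℝ) : ℂ)) 2 := by
  refine memℓp_gen ?_
  refine (hasSum_expCoeff_mul z z).1.congr fun k => ?_
  simp [pow_two]

/-- The exponential vector `|e(z)⟩ = ∑ₖ z ^ k / √(k!) |k⟩`. -/
def expVec (z : Fin n → ℂ) : Fock n :=
  ⟨fun k => multiPow z k / (√(multiFactorial k : ℝ) : ℂ), memℓp_expCoeff z⟩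

/-- `⟨e(u)|e(z)⟩ = exp ⟨u|z⟩`. -/
theorem inner_expVec (u z : Fin n → ℂ) :
    ⟪expVec u, expVec z⟫_ℂ = Complex.exp (star u ⬝ᵥ z) := by
  rw [lp.inner_eq_tsum, ← (hasSum_expCoeff_mul u z).2.tsum_eq]
  refine tsum_congr fun k => ?_
  simp [expVec, mul_comm]

/-- The coherent state `|ψ(z)⟩ = exp (- ‖z‖² / 2) |e(z)⟩`. -/
def coherent (z : Fin n → ℂ) : Fock n :=
  (Real.exp (-(∑ i, ‖z i‖ ^ 2) / 2) : ℂ) • expVec z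

/-! ### Weyl operators -/

/-- `∑ f(z) δ_z ↦ ∑ f(z) |ψ(z)⟩`, on finite combinations. -/
def coherentSum (n : ℕ) : ((Fin n → ℂ) →₀ ℂ) →ₗ[ℂ] Fock n :=
  Finsupp.linearCombination ℂ coherent

/-- `∑ f(z) δ_z ↦ ∑ f(z) exp (- i Im ⟨u|z⟩) |ψ(u + z)⟩`, on finite combinations. -/
def displacedSum (u : Fin n → ℂ) : ((Fin n → ℂ) →₀ ℂ) →ₗ[ℂ] Fock n :=
  Finsupp.linearCombination ℂ fun z =>
    Complex.exp (-Complex.I * ((star u ⬝ᵥ z).im : ℂ)) • coherent (u + z)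

/-- The Weyl (displacement) operator `W(u)`: the continuous linear extension of
`|ψ(z)⟩ ↦ exp (- i Im ⟨u|z⟩) |ψ(u + z)⟩` from the span of the coherent states, which is dense.
See `weyl_coherent`. -/
def weyl (u : Fin n → ℂ) : Fock n →L[ℂ] Fock n :=
  (displacedSum u).extendOfNorm (coherentSum n)

theorem inner_coherent (z w : Fin n → ℂ) :
    ⟪coherent z, coherent w⟫_ℂ =
      Complex.exp (star z ⬝ᵥ w - (star z ⬝ᵥ z) / 2 - (star w ⬝ᵥ w) / 2) := by
  have h : ∀ z : Fin n → ℂ, ((∑ i, ‖z i‖ ^ 2 : ℝ) : ℂ) = star z ⬝ᵥ z := by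
    intro z
    simp only [dotProduct, Pi.star_apply, RCLike.star_def, Complex.conj_mul']
    push_cast
    rfl
  rw [coherent, coherent, inner_smul_left, inner_smul_right, inner_expVec, Complex.conj_ofReal]
  rw [Complex.ofReal_exp, Complex.ofReal_exp, ← Complex.exp_add, ← Complex.exp_add]
  congr 1
  rw [← h z, ← h w]
  push_cast
  ring

theorem inner_displaced (u z w : Fin n → ℂ) :
    ⟪Complex.exp (-Complex.I * ((star u ⬝ᵥ z).im : ℂ)) • coherent (u + z),
      Complex.exp (-Complex.I * ((star u ⬝ᵥ w).im : ℂ)) • coherent (u + w)⟫_ℂ =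
    ⟪coherent z, coherent w⟫_ℂ := by
  have him : ∀ z : Fin n → ℂ,
      Complex.I * ((star u ⬝ᵥ z).im : ℂ) = (star u ⬝ᵥ z - star z ⬝ᵥ u) / 2 := by
    intro z
    have h : star z ⬝ᵥ u = conj (star u ⬝ᵥ z) := by
      simp [dotProduct, map_sum, mul_comm]
    rw [h]
    apply Complex.ext <;> simp
  rw [inner_smul_left, inner_smul_right, inner_coherent, inner_coherent, ← Complex.exp_conj,
    ← Complex.exp_add, ← Complex.exp_add]
  congr 1
  have hc : conj (-Complex.I * ((star u ⬝ᵥ z).im : ℂ)) =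
      Complex.I * ((star u ⬝ᵥ z).im : ℂ) := by
    simp
  rw [hc, neg_mul, him, him]
  simp only [star_add, add_dotProduct, dotProduct_add]
  ring

theorem norm_displacedSum (u : Fin n → ℂ) (f : (Fin n → ℂ) →₀ ℂ) :
    ‖displacedSum u f‖ = ‖coherentSum n f‖ := by
  have h : ⟪displacedSum u f, displacedSum u f⟫_ℂ = ⟪coherentSum n f, coherentSum n f⟫_ℂ := by
    simp only [displacedSum, coherentSum, Finsupp.linearCombination_apply, Finsupp.sum,
      sum_inner, inner_sum]
    refine Finset.sum_congr rfl fun z _ => Finset.sum_congr rfl fun w _ => ?_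
    rw [inner_smul_left (r := f w), inner_smul_left (r := f w), inner_smul_right (r := f z),
      inner_smul_right (r := f z), inner_displaced]
  rw [inner_self_eq_norm_sq_to_K, inner_self_eq_norm_sq_to_K] at h
  have h2 : ‖displacedSum u f‖ ^ 2 = ‖coherentSum n f‖ ^ 2 := by exact_mod_cast h
  exact (sq_eq_sq₀ (norm_nonneg _) (norm_nonneg _)).1 h2

open UnitAddTorus in
/-- A vector orthogonal to every exponential vector vanishes. -/
theorem eq_zero_of_inner_expVec (f : Fock n) (hf : ∀ z, ⟪f, expVec z⟫_ℂ = 0) : f = 0 := by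
  set a : (Fin n → ℕ) → ℂ := fun k => conj (f k) / (√(multiFactorial k : ℝ) : ℂ) with ha
  have h0 : ∀ z : Fin n → ℂ, HasSum (fun k => a k * multiPow z k) 0 := by
    intro z
    have := lp.hasSum_inner (𝕜 := ℂ) f (expVec z)
    rw [hf] at this
    refine this.congr_fun fun k => ?_
    simp [expVec, ha]
    ring
  have hsum : Summable fun k => ‖a k‖ := by
    have := (h0 (fun _ => 1)).summable.norm
    simpa [multiPow] using this
  let g : (Fin n → ℕ) → C(UnitAddTorus (Fin n), ℂ) :=
    fun k => a k • mFourier (fun i => (k i : ℤ))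
  have hg : Summable g := by
    refine Summable.of_norm (hsum.congr fun k => ?_)
    simp [g, norm_smul, mFourier_norm]
  have hg0 : HasSum g 0 := by
    have h1 := hg.hasSum
    have h2 : ∑' k, g k = 0 := by
      ext x
      have h3 := (ContinuousMap.evalCLM ℂ x).hasSum h1
      have h4 := h0 (fun i => fourier 1 (x i))
      refine h3.unique (h4.congr_fun fun k => ?_)
      simp [g, mFourier, multiPow, fourier_apply, ContinuousMap.evalCLM, AddCircle.toCircle_nsmul]
    rwa [h2] at h1
  let _ : MeasureTheory.MeasureSpace UnitAddCircle := ⟨AddCircle.haarAddCircle⟩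
  have _ : MeasureTheory.IsProbabilityMeasure (MeasureTheory.volume : MeasureTheory.Measure UnitAddCircle) :=
    inferInstanceAs (MeasureTheory.IsProbabilityMeasure AddCircle.haarAddCircle)
  have hL := (ContinuousMap.toLp (E := ℂ) 2
    (MeasureTheory.volume : MeasureTheory.Measure (UnitAddTorus (Fin n))) ℂ).hasSum hg0
  have hort := orthonormal_iff_ite.1 (orthonormal_mFourier (d := Fin n))
  have hcoef : ∀ k, a k = 0 := by
    intro k
    have h1 := (innerSL ℂ (mFourierLp 2 (fun i => (k i : ℤ)))).hasSum hL
    have h3 : ∀ l, innerSL ℂ (mFourierLp 2 (fun i => (k i : ℤ))) (ContinuousMap.toLp (E := ℂ) 2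
        (MeasureTheory.volume : MeasureTheory.Measure (UnitAddTorus (Fin n))) ℂ (g l)) =
        if k = l then a l else 0 := by
      intro l
      have h4 := hort (fun i => (k i : ℤ)) (fun i => (l i : ℤ))
      have h5 : ((fun i => (k i : ℤ)) = fun i => (l i : ℤ)) ↔ k = l := by
        simp [funext_iff]
      rw [map_smul, innerSL_apply_apply, inner_smul_right]
      erw [h4]
      simp [h5]
    simp only [h3, map_zero] at h1
    have h2 := h1.unique (hasSum_single k fun l hl => if_neg hl.symm)
    simpa using h2.symm
  ext k
  have h1 := hcoef k
  have h2 : (√(multiFactorial k : ℝ) : ℂ) ≠ 0 := by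
    have : 0 < (multiFactorial k : ℝ) := by
      exact_mod_cast Finset.prod_pos fun i _ => Nat.factorial_pos _
    exact_mod_cast (Real.sqrt_pos.2 this).ne'
  simpa [ha, h2] using h1

theorem denseRange_coherentSum : DenseRange (coherentSum n) := by
  have h : (LinearMap.range (coherentSum n)).topologicalClosure = ⊤ := by
    rw [Submodule.topologicalClosure_eq_top_iff, Submodule.eq_bot_iff]
    intro f hf
    refine eq_zero_of_inner_expVec f fun z => ?_
    have h1 := (Submodule.mem_orthogonal' _ f).1 hf (coherentSum n (Finsupp.single z 1)) ⟨_, rfl⟩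
    rw [coherentSum, Finsupp.linearCombination_single, one_smul, coherent, inner_smul_right] at h1
    refine (mul_eq_zero.1 h1).resolve_left ?_
    exact_mod_cast (Real.exp_pos _).ne'
  have := (Submodule.dense_iff_topologicalClosure_eq_top).2 h
  simpa only [DenseRange, LinearMap.coe_range] using this

/-- `W(u) |ψ(z)⟩ = exp (- i Im ⟨u|z⟩) |ψ(u + z)⟩`. -/
theorem weyl_coherent (u z : Fin n → ℂ) :
    weyl u (coherent z) =
      Complex.exp (-Complex.I * ((star u ⬝ᵥ z).im : ℂ)) • coherent (u + z) := by
  have h := LinearMap.extendOfNorm_eq (f := displacedSum u) (e := coherentSum n)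
    denseRange_coherentSum ⟨1, fun f => by rw [one_mul, norm_displacedSum]⟩ (Finsupp.single z 1)
  simpa [weyl, coherentSum, displacedSum, Finsupp.linearCombination_single] using h

/-! ### States, quantum characteristic function, gaussian states -/

/-- The trace `∑ₖ ⟨k|T|k⟩` in the particle basis exists and equals `a`. It is only applied to
positive operators, and to products of a positive operator of finite trace with a bounded operator,
where the value does not depend on the orthonormal basis. -/
def HasTrace (T : Fock n →L[ℂ] Fock n) (a : ℂ) : Prop :=
  HasSum (fun k => ⟪ket k, T (ket k)⟫_ℂ) a

/-- A state: a positive operator of unit trace. -/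
def IsState (ρ : Fock n →L[ℂ] Fock n) : Prop :=
  ρ.IsPositive ∧ HasTrace ρ 1

/-- A state is gaussian with mean annihilation vector `m` and position-momentum covariance matrix
`S` if its quantum characteristic function `tr (ρ W(z))`, `z = x + i y`, is
`exp (- 2 i Im ⟨z|m⟩ - (x, y)ᵀ S (x, y))`. -/
def IsGaussianStateWith (ρ : Fock n →L[ℂ] Fock n) (m : Fin n → ℂ)
    (S : Matrix (Fin n ⊕ Fin n) (Fin n ⊕ Fin n) ℝ) : Prop :=
  IsState ρ ∧ S.IsSymm ∧ ∀ z : Fin n → ℂ,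
    HasTrace (ρ ∘L weyl z)
      (Complex.exp (-2 * Complex.I * ((star z ⬝ᵥ m).im : ℂ) -
        ((Sum.elim (fun i => (z i).re) (fun i => (z i).im) ⬝ᵥ
          S *ᵥ Sum.elim (fun i => (z i).re) (fun i => (z i).im) : ℝ) : ℂ)))

/-- `|ψ⟩⟨ψ|`. -/
def ketbra (ψ : Fock n) : Fock n →L[ℂ] Fock n := InnerProductSpace.rankOne ℂ ψ ψ

/-- `ψ` is a unit vector and `|ψ⟩⟨ψ|` is a gaussian state with mean zero. -/
def IsMeanZeroPureGaussian (ψ : Fock n) : Prop :=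
  ‖ψ‖ = 1 ∧ ∃ S, IsGaussianStateWith (ketbra ψ) 0 S

/-! ### The class `𝓔₂` -/

/-- The generating function `G_Z(u, v) = ⟨e(ū)|Z|e(v)⟩`. -/
def genFun (Z : Fock n →L[ℂ] Fock n) (u v : Fin n → ℂ) : ℂ :=
  ⟪expVec (star u), Z (expVec v)⟫_ℂ

/-- `(c, α, β, A, Λ, B)` are the `𝓔₂`-parameters of the bounded operator `Z`. -/
def HasE2Params (Z : Fock n →L[ℂ] Fock n) (c : ℂ) (α β : Fin n → ℂ)
    (A Λ B : Matrix (Fin n) (Fin n) ℂ) : Prop :=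
  A.IsSymm ∧ B.IsSymm ∧ ∀ u v : Fin n → ℂ, genFun Z u v =
    c * Complex.exp (u ⬝ᵥ α + β ⬝ᵥ v + u ⬝ᵥ A *ᵥ u + u ⬝ᵥ Λ *ᵥ v + v ⬝ᵥ B *ᵥ v)

/-- `Z` is a positive operator with `𝓔₂`-parameters `(c, α, A, Λ)`, which abbreviates
`(c, α, ᾱ, A, Λ, Ā)`. -/
def IsPositiveWithE2Params (Z : Fock n →L[ℂ] Fock n) (c : ℝ) (α : Fin n → ℂ)
    (A Λ : Matrix (Fin n) (Fin n) ℂ) : Prop :=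
  Z.IsPositive ∧ HasE2Params Z c α (star α) A Λ (A.map conj)

/-! ### The coefficients `φ_B` -/

/-- `r̃(R)ᵢ = ∑_{j ≤ i} r_{ji} + ∑_{j ≥ i} r_{ij}`. -/
def rTilde (R : Matrix (Fin n) (Fin n) ℕ) (i : Fin n) : ℕ :=
  ∑ j ∈ Finset.Iic i, R j i + ∑ j ∈ Finset.Ici i, R i j

/-- `Δ(t)`: upper triangular matrices `R` with entries in `ℤ₊` and `r̃(R) = t`. -/
def Delta (t : Fin n → ℕ) : Set (Matrix (Fin n) (Fin n) ℕ) :=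
  {R | (∀ i j, j < i → R i j = 0) ∧ rTilde R = t}

theorem finite_Delta (t : Fin n → ℕ) : (Delta t).Finite := by
  refine (Set.Finite.pi' fun i => Set.Finite.pi' fun _ : Fin n => Set.finite_Iic (t i)).subset ?_
  rintro R ⟨h1, rfl⟩ i j
  rw [Set.mem_Iic]
  rcases lt_or_ge j i with h | h
  · simp [h1 i j h]
  · exact (Finset.single_le_sum (f := fun j => R i j) (fun _ _ => Nat.zero_le _)
      (Finset.mem_Ici.2 h)).trans (Nat.le_add_left _ _)

/-- `φ_B(t) = √(t!) ∑_{R ∈ Δ(t)} 2 ^ (|R| - tr R) ∏ b_{ij} ^ r_{ij} / R!`. -/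
def phi (B : Matrix (Fin n) (Fin n) ℂ) (t : Fin n → ℕ) : ℂ :=
  (√(multiFactorial t : ℝ) : ℂ) * ∑ R ∈ (finite_Delta t).toFinset,
    2 ^ ((∑ i, ∑ j, R i j) - R.trace) *
      ((∏ i, ∏ j, B i j ^ R i j) / ((∏ i, ∏ j, (R i j).factorial : ℕ) : ℂ))

/-! ### The normalization constant `c(A, Λ)` -/

/-- `M(A, Λ) = I - [Re Λ, -Im Λ; Im Λ, Re Λ] - 2 [Re A, Im A; Im A, -Re A]`. -/
def bigM (A Λ : Matrix (Fin n) (Fin n) ℂ) : Matrix (Fin n ⊕ Fin n) (Fin n ⊕ Fin n) ℝ :=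
  1 - Matrix.fromBlocks (Λ.map Complex.re) (-Λ.map Complex.im) (Λ.map Complex.im) (Λ.map Complex.re)
    - 2 • Matrix.fromBlocks (A.map Complex.re) (A.map Complex.im)
        (A.map Complex.im) (-A.map Complex.re)

/-- `c(A, Λ) = √(det M(A, Λ))`, used when `M(A, Λ) ≥ 0`. -/
def cConst (A Λ : Matrix (Fin n) (Fin n) ℂ) : ℝ := √(bigM A Λ).det

end BosonFock

end

open BosonFock

namespace BosonFock

/-! Pairing with exponential vectors turns a Fock vector into an entire power series that determines
it, and expanding exp(uᵀAu) shows that the φ_A(t) are the coefficients belonging to that function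
(`hasSum_phi`). If Z has parameters (c, 0, A, 0), then Z|e(0)⟩ has coefficients c φ_A(t), so these
are square summable. Conversely, if Σ φ_A(t)|t⟩ converges to a vector φ, the rank one operator
c|φ⟩⟨φ| has the required generating function, which factors into a function of u times a function of
v; a generating function determines its operator, so Z is this one.

For the normalization and the gaussian property, coherent states give a resolution of the identity:
inner products in Fock space are π⁻ⁿ times integrals over ℝ²ⁿ of Bargmann transforms
(`integral_bargmann`). The transform of φ has squared modulus exp(-pᵀM(A,0)p). Integrability of this
gaussian forces M(A,0) > 0 and gives ‖φ‖² = 1/c(A,0). A Weyl operator only adds a constant and a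
complex linear term to the exponent, so ⟨φ|W(w)φ⟩ is again an explicit gaussian integral
(`inner_phiVec_weyl`). -/

/-! ### Power series and the generating function of φ_A. -/

open UnitAddTorus in
/-- The coefficients of an everywhere convergent power series are determined by its sum. -/
theorem coeff_eq_zero_of_hasSum {n : ℕ} (a : (Fin n → ℕ) → ℂ)
    (h0 : ∀ z : Fin n → ℂ, HasSum (fun k => a k * multiPow z k) 0) (k : Fin n → ℕ) : a k = 0 := by
  have hsum : Summable fun k => ‖a k‖ := by
    have := (h0 (fun _ => 1)).summable.norm
    simpa [multiPow] using this
  -- On the torus |zᵢ| = 1 the power series becomes a uniformly convergent Fourier series with sum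
  -- 0; orthogonality of the characters isolates each coefficient. Absolute summability is
  -- convergence at z = (1, …, 1).
  let g : (Fin n → ℕ) → C(UnitAddTorus (Fin n), ℂ) :=
    fun k => a k • mFourier (fun i => (k i : ℤ))
  have hg : Summable g := by
    refine Summable.of_norm (hsum.congr fun k => ?_)
    simp [g, norm_smul, mFourier_norm]
  have hg0 : HasSum g 0 := by
    have h1 := hg.hasSum
    have h2 : ∑' k, g k = 0 := by
      ext x
      have h3 := (ContinuousMap.evalCLM ℂ x).hasSum h1
      have h4 := h0 (fun i => fourier 1 (x i))
      refine h3.unique (h4.congr_fun fun k => ?_)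
      simp [g, mFourier, multiPow, fourier_apply, ContinuousMap.evalCLM, AddCircle.toCircle_nsmul]
    rwa [h2] at h1
  let _ : MeasureTheory.MeasureSpace UnitAddCircle := ⟨AddCircle.haarAddCircle⟩
  have _ : MeasureTheory.IsProbabilityMeasure
      (MeasureTheory.volume : MeasureTheory.Measure UnitAddCircle) :=
    inferInstanceAs (MeasureTheory.IsProbabilityMeasure AddCircle.haarAddCircle)
  have hL := (ContinuousMap.toLp (E := ℂ) 2
    (MeasureTheory.volume : MeasureTheory.Measure (UnitAddTorus (Fin n))) ℂ).hasSum hg0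
  have hort := orthonormal_iff_ite.1 (orthonormal_mFourier (d := Fin n))
  have h1 := (innerSL ℂ (mFourierLp 2 (fun i => (k i : ℤ)))).hasSum hL
  have h3 : ∀ l, innerSL ℂ (mFourierLp 2 (fun i => (k i : ℤ))) (ContinuousMap.toLp (E := ℂ) 2
      (MeasureTheory.volume : MeasureTheory.Measure (UnitAddTorus (Fin n))) ℂ (g l)) =
      if k = l then a l else 0 := by
    intro l
    have h4 := hort (fun i => (k i : ℤ)) (fun i => (l i : ℤ))
    have h5 : ((fun i => (k i : ℤ)) = fun i => (l i : ℤ)) ↔ k = l := by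
      simp [funext_iff]
    rw [map_smul, innerSL_apply_apply, inner_smul_right]
    erw [h4]
    simp [h5]
  simp only [h3, map_zero] at h1
  have h2 := h1.unique (hasSum_single k fun l hl => if_neg hl.symm)
  simpa using h2.symm

/-- The product of the exponential series of a matrix of complex numbers. -/
theorem hasSum_matrix_exp {n : ℕ} (c : Fin n → Fin n → ℂ) :
    HasSum (fun R : Matrix (Fin n) (Fin n) ℕ => ∏ i, ∏ j, c i j ^ R i j / ((R i j).factorial : ℂ))
      (Complex.exp (∑ i, ∑ j, c i j)) := by
  -- Matrices are flattened to vectors of length n² so that `hasSum_pi_prod` applies.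
  let e : (Fin (n * n) → ℕ) ≃ Matrix (Fin n) (Fin n) ℕ :=
    (Equiv.arrowCongr finProdFinEquiv.symm (Equiv.refl ℕ)).trans (Equiv.curry _ _ _)
  have hs := (hasSum_pi_prod (fun (l : Fin (n * n)) m =>
    (c (finProdFinEquiv.symm l).1 (finProdFinEquiv.symm l).2) ^ m / (m.factorial : ℂ))
    (fun i => NormedSpace.norm_expSeries_div_summable _)).2
  rw [← e.hasSum_iff]
  convert hs using 1
  · ext k
    rw [← finProdFinEquiv.prod_comp, Fintype.prod_prod_type]
    simp only [Function.comp_apply, Equiv.symm_apply_apply]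
    rfl
  · rw [← finProdFinEquiv.prod_comp, Fintype.prod_prod_type]
    simp only [Complex.exp_sum, Equiv.symm_apply_apply]
    refine Finset.prod_congr rfl fun i _ => Finset.prod_congr rfl fun j _ => ?_
    rw [Complex.exp_eq_exp_ℂ, NormedSpace.exp_eq_tsum_div]

/-- The coefficients of the quadratic form of a symmetric matrix, collected above the diagonal. -/
def triangularCoeff {n : ℕ} (A : Matrix (Fin n) (Fin n) ℂ) (i j : Fin n) : ℂ :=
  if j < i then 0 else if i = j then A i j else 2 * A i j

/-- Adding the sum to its transpose gives coefficient 2aᵢⱼ everywhere, diagonal included, hence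
twice the quadratic form; by symmetry of uᵢuⱼ the two sums agree. -/
theorem sum_triangularCoeff {n : ℕ} {A : Matrix (Fin n) (Fin n) ℂ} (hA : A.IsSymm)
    (u : Fin n → ℂ) :
    ∑ i, ∑ j, triangularCoeff A i j * (u i * u j) = u ⬝ᵥ A *ᵥ u := by
  have h : ∀ i j, triangularCoeff A i j + triangularCoeff A j i = 2 * A i j := by
    intro i j
    have := hA.apply i j
    rcases lt_trichotomy i j with h | h | h
    · simp [triangularCoeff, h, h.not_gt, h.ne]
    · subst h; simp [triangularCoeff]; ring
    · simp [triangularCoeff, h, h.not_gt, h.ne, this]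
  have h2 : ∑ i, ∑ j, triangularCoeff A i j * (u i * u j) =
      ∑ i, ∑ j, triangularCoeff A j i * (u i * u j) := by
    rw [Finset.sum_comm]
    simp only [mul_comm]
  have h3 : 2 * (u ⬝ᵥ A *ᵥ u) = ∑ i, ∑ j, triangularCoeff A i j * (u i * u j) +
      ∑ i, ∑ j, triangularCoeff A j i * (u i * u j) := by
    simp only [dotProduct, Matrix.mulVec, Finset.mul_sum, ← Finset.sum_add_distrib, ← add_mul, h]
    refine Finset.sum_congr rfl fun i _ => Finset.sum_congr rfl fun j _ => ?_
    ring
  rw [← h2] at h3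
  linear_combination -h3 / 2

theorem rTilde_of_upper {n : ℕ} {R : Matrix (Fin n) (Fin n) ℕ} (hR : ∀ i j, j < i → R i j = 0)
    (i : Fin n) : rTilde R i = ∑ j, R j i + ∑ j, R i j := by
  unfold rTilde
  congr 1
  · refine Finset.sum_subset (Finset.subset_univ _) fun j _ hj => hR _ _ ?_
    simpa using hj
  · refine Finset.sum_subset (Finset.subset_univ _) fun j _ hj => hR _ _ ?_
    simpa using hj

theorem prod_mul_pow_of_upper {n : ℕ} {R : Matrix (Fin n) (Fin n) ℕ}
    (hR : ∀ i j, j < i → R i j = 0) (u : Fin n → ℂ) :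
    ∏ i, ∏ j, (u i * u j) ^ R i j = multiPow u (rTilde R) := by
  simp only [multiPow, rTilde_of_upper hR, pow_add, mul_pow, Finset.prod_mul_distrib,
    Finset.prod_pow_eq_pow_sum]
  rw [mul_comm]
  congr 1
  rw [Finset.prod_comm]
  simp only [Finset.prod_pow_eq_pow_sum]

/-- Each off-diagonal entry contributes a factor 2 and the diagonal none, which is where the power
|R| - tr R in φ_A comes from. -/
theorem prod_triangularCoeff_pow {n : ℕ} (A : Matrix (Fin n) (Fin n) ℂ)
    {R : Matrix (Fin n) (Fin n) ℕ} (hR : ∀ i j, j < i → R i j = 0) :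
    ∏ i, ∏ j, triangularCoeff A i j ^ R i j =
      2 ^ ((∑ i, ∑ j, R i j) - R.trace) * ∏ i, ∏ j, A i j ^ R i j := by
  have h1 : ∀ i j, triangularCoeff A i j ^ R i j =
      2 ^ (R i j - if i = j then R i j else 0) * A i j ^ R i j := by
    intro i j
    rcases lt_trichotomy i j with h | h | h
    · simp [triangularCoeff, h.not_gt, h.ne, mul_pow]
    · subst h; simp [triangularCoeff]
    · simp [hR i j h]
  -- The subtraction is truncated, so tr R ≤ |R| has to be checked before it distributes over the
  -- entries.
  have h2 : (∑ i, ∑ j, R i j) - R.trace = ∑ i, ∑ j, (R i j - if i = j then R i j else 0) := by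
    have : R.trace = ∑ i, ∑ j, if i = j then R i j else 0 := by simp [Matrix.trace]
    rw [this, Nat.sub_eq_iff_eq_add]
    · simp only [← Finset.sum_add_distrib]
      refine Finset.sum_congr rfl fun i _ => Finset.sum_congr rfl fun j _ => ?_
      split_ifs <;> simp
    · refine Finset.sum_le_sum fun i _ => Finset.sum_le_sum fun j _ => ?_
      split_ifs <;> simp
  simp only [h1, h2, Finset.prod_mul_distrib, Finset.prod_pow_eq_pow_sum]

/-- The generating function of the coefficients `φ_A` is `exp (uᵀ A u)`. -/
theorem hasSum_phi {n : ℕ} {A : Matrix (Fin n) (Fin n) ℂ} (hA : A.IsSymm) (u : Fin n → ℂ) :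
    HasSum (fun t => phi A t * (multiPow u t / (√(multiFactorial t : ℝ) : ℂ)))
      (Complex.exp (u ⬝ᵥ A *ᵥ u)) := by
  have h := hasSum_matrix_exp fun i j => triangularCoeff A i j * (u i * u j)
  rw [sum_triangularCoeff hA] at h
  -- The series over all R is grouped along the fibres of `rTilde`. Terms with R not upper
  -- triangular vanish, so the fibre over t reduces to the finite set `Delta t`.
  have h2 := (HasSum.sigma ((Equiv.sigmaFiberEquiv (rTilde (n := n))).hasSum_iff.2 h)
    fun t => ((((Equiv.sigmaFiberEquiv (rTilde (n := n))).hasSum_iff.2 h)).summable.sigma_factor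
      t).hasSum)
  refine h2.congr_fun fun t => ?_
  have hz : ∀ R : Matrix (Fin n) (Fin n) ℕ, (¬ ∀ i j, j < i → R i j = 0) →
      ∏ i, ∏ j, (triangularCoeff A i j * (u i * u j)) ^ R i j / ((R i j).factorial : ℂ) = 0 := by
    intro R hR
    push Not at hR
    obtain ⟨i, j, hij, hR⟩ := hR
    refine Finset.prod_eq_zero (Finset.mem_univ i) (Finset.prod_eq_zero (Finset.mem_univ j) ?_)
    simp [triangularCoeff, hij, hR]
  refine Eq.trans ?_ (tsum_subtype {R | rTilde R = t} fun R : Matrix (Fin n) (Fin n) ℕ =>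
    ∏ i, ∏ j, (triangularCoeff A i j * (u i * u j)) ^ R i j / ((R i j).factorial : ℂ)).symm
  rw [tsum_eq_sum (s := (finite_Delta t).toFinset)]
  · have hne : (√(multiFactorial t : ℝ) : ℂ) ≠ 0 := by
      have : 0 < (multiFactorial t : ℝ) := by
        exact_mod_cast Finset.prod_pos fun i _ => Nat.factorial_pos _
      exact_mod_cast (Real.sqrt_pos.2 this).ne'
    rw [phi, mul_comm (√(multiFactorial t : ℝ) : ℂ), mul_assoc, mul_div_cancel₀ _ hne,
      Finset.sum_mul]
    refine Finset.sum_congr rfl fun R hR => ?_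
    obtain ⟨hR1, hR2⟩ := (Set.Finite.mem_toFinset _).1 hR
    rw [Set.indicator_of_mem (by exact hR2)]
    simp only [Finset.prod_div_distrib, mul_pow (triangularCoeff A _ _), Finset.prod_mul_distrib]
    rw [prod_triangularCoeff_pow A hR1, prod_mul_pow_of_upper hR1, hR2]
    push_cast
    ring
  · intro R hR
    by_cases h3 : rTilde R = t
    · rw [Set.indicator_of_mem (by exact h3)]
      refine hz R fun h4 => hR ?_
      exact (Set.Finite.mem_toFinset _).2 ⟨h4, h3⟩
    · rw [Set.indicator_of_notMem (by exact h3)]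

/-! ### Vectors and operators determined by exponential vectors. -/

theorem sqrt_multiFactorial_ne_zero {n : ℕ} (k : Fin n → ℕ) :
    (√(multiFactorial k : ℝ) : ℂ) ≠ 0 := by
  have : 0 < (multiFactorial k : ℝ) := by
    exact_mod_cast Finset.prod_pos fun i _ => Nat.factorial_pos _
  exact_mod_cast (Real.sqrt_pos.2 this).ne'

theorem hasSum_inner_expVec {n : ℕ} (f : Fock n) (z : Fin n → ℂ) :
    HasSum (fun k => f k * (multiPow (star z) k / (√(multiFactorial k : ℝ) : ℂ)))
      ⟪expVec z, f⟫_ℂ := by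
  refine (lp.hasSum_inner (𝕜 := ℂ) (expVec z) f).congr_fun fun k => ?_
  simp [expVec, multiPow]

/-- A vector of the Fock space is determined by its power series `⟨e(ū)|f⟩`. -/
theorem coeff_eq_phi {n : ℕ} {A : Matrix (Fin n) (Fin n) ℂ} (hA : A.IsSymm) (c : ℂ) (f : Fock n)
    (hf : ∀ u, ⟪expVec (star u), f⟫_ℂ = c * Complex.exp (u ⬝ᵥ A *ᵥ u)) (t : Fin n → ℕ) :
    f t = c * phi A t := by
  have h := coeff_eq_zero_of_hasSum
    (fun t => (f t - c * phi A t) / (√(multiFactorial t : ℝ) : ℂ)) (fun u => ?_) t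
  · rw [div_eq_zero_iff] at h
    exact sub_eq_zero.1 (h.resolve_right (sqrt_multiFactorial_ne_zero t))
  · have h1 := (hasSum_inner_expVec f (star u)).sub ((hasSum_phi hA u).mul_left c)
    rw [hf, sub_self, star_star] at h1
    refine h1.congr_fun fun k => ?_
    ring

theorem dense_span_expVec (n : ℕ) :
    (Submodule.span ℂ (Set.range (expVec (n := n)))).topologicalClosure = ⊤ := by
  rw [Submodule.topologicalClosure_eq_top_iff, Submodule.eq_bot_iff]
  intro f hf
  exact eq_zero_of_inner_expVec f fun z =>
    (Submodule.mem_orthogonal' _ f).1 hf _ (Submodule.subset_span ⟨z, rfl⟩)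

/-- Bounded operators that agree on the exponential vectors are equal. -/
theorem ext_of_expVec {n : ℕ} {E : Type*} [AddCommMonoid E] [TopologicalSpace E] [T2Space E]
    [Module ℂ E] {S T : Fock n →L[ℂ] E} (h : ∀ z, S (expVec z) = T (expVec z)) : S = T := by
  refine ContinuousLinearMap.ext_on
    (Submodule.dense_iff_topologicalClosure_eq_top.2 (dense_span_expVec n)) ?_
  rintro _ ⟨z, rfl⟩
  exact h z

/-- A bounded operator is determined by its generating function. -/
theorem eq_of_genFun_eq {n : ℕ} {S T : Fock n →L[ℂ] Fock n}
    (h : ∀ u v, genFun S u v = genFun T u v) : S = T := by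
  refine ext_of_expVec fun v => ?_
  rw [← sub_eq_zero]
  refine eq_zero_of_inner_expVec _ fun z => ?_
  have h1 := h (star z) v
  rw [genFun, genFun, star_star, ← sub_eq_zero, ← inner_sub_right] at h1
  rw [← inner_conj_symm, h1, map_zero]

/-- Putting v = 0 in the generating function identifies the coefficients of Z|e(0)⟩ as c φ_A(t), and
that vector lies in ℓ². -/
theorem summable_phi_of_isPositiveWithE2Params {n : ℕ} {c : ℝ} (hc : 0 < c)
    {A : Matrix (Fin n) (Fin n) ℂ} (hA : A.IsSymm) {Z : Fock n →L[ℂ] Fock n}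
    (hZ : IsPositiveWithE2Params Z c 0 A 0) : Summable fun t : Fin n → ℕ => ‖phi A t‖ ^ 2 := by
  have h1 : ∀ t, Z (expVec 0) t = c * phi A t := by
    refine coeff_eq_phi hA c _ fun u => ?_
    have := hZ.2.2.2 u 0
    simpa [genFun] using this
  have h2 := (lp.memℓp (Z (expVec 0))).summable (p := 2) (by simp)
  have h3 : Summable fun t => c ^ 2 * ‖phi A t‖ ^ 2 := by
    refine h2.congr fun t => ?_
    rw [h1, norm_mul, Complex.norm_real]
    simp [mul_pow]
  exact (summable_mul_left_iff (by positivity)).1 h3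

/-! ### The vector Σ φ_A(t)|t⟩ and its rank one operators. -/

/-- The vector with coefficients `φ_A(t)`. -/
noncomputable def phiVec {n : ℕ} (A : Matrix (Fin n) (Fin n) ℂ)
    (h : Summable fun t : Fin n → ℕ => ‖phi A t‖ ^ 2) : Fock n :=
  ⟨phi A, memℓp_gen (by simpa using h)⟩

theorem hasSum_phiVec {n : ℕ} (A : Matrix (Fin n) (Fin n) ℂ)
    (h : Summable fun t : Fin n → ℕ => ‖phi A t‖ ^ 2) (a : ℂ) :
    HasSum (fun t => (a * phi A t) • ket t) (a • phiVec A h) := by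
  have h1 := (lp.hasSum_single (p := 2) (by simp) (phiVec A h)).const_smul a
  refine h1.congr_fun fun t => ?_
  rw [mul_smul, ket, ← lp.single_smul]
  simp [phiVec]

theorem inner_expVec_phiVec {n : ℕ} {A : Matrix (Fin n) (Fin n) ℂ} (hA : A.IsSymm)
    (h : Summable fun t : Fin n → ℕ => ‖phi A t‖ ^ 2) (z : Fin n → ℂ) :
    ⟪expVec z, phiVec A h⟫_ℂ = Complex.exp (star z ⬝ᵥ A *ᵥ star z) :=
  (hasSum_inner_expVec _ z).unique (hasSum_phi hA (star z))

theorem isPositive_ketbra {n : ℕ} (ψ : Fock n) : (ketbra ψ).IsPositive :=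
  InnerProductSpace.isPositive_rankOne_self ψ

/-- With no mixed term uᵀΛv the exponential splits as ⟨e(ū)|ψ⟩⟨ψ|e(v)⟩, the second factor being a
complex conjugate. It serves both for the given c and for c(A,0). -/
theorem isPositiveWithE2Params_ketbra {n : ℕ} {A : Matrix (Fin n) (Fin n) ℂ} (hA : A.IsSymm)
    (h : Summable fun t : Fin n → ℕ => ‖phi A t‖ ^ 2) {c : ℝ} (hc : 0 ≤ c) :
    IsPositiveWithE2Params (ketbra ((√c : ℂ) • phiVec A h)) c 0 A 0 := by
  refine ⟨isPositive_ketbra _, hA, ?_, fun u v => ?_⟩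
  · exact hA.map _
  · have h1 : ⟪phiVec A h, expVec v⟫_ℂ = Complex.exp (v ⬝ᵥ A.map conj *ᵥ v) := by
      rw [← inner_conj_symm, inner_expVec_phiVec hA, ← Complex.exp_conj]
      simp [dotProduct, Matrix.mulVec, map_sum]
    have h2 : (√c : ℂ) * (√c : ℂ) = c := by
      rw [← Complex.ofReal_mul, Real.mul_self_sqrt hc]
    rw [genFun, ketbra, InnerProductSpace.rankOne_apply, inner_smul_right, inner_smul_right,
      inner_smul_left, inner_expVec_phiVec hA, h1, Complex.conj_ofReal, star_star]
    simp only [star_zero, dotProduct_zero, zero_dotProduct, Matrix.zero_mulVec, zero_add, add_zero,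
      Complex.exp_add]
    rw [← h2]
    ring

theorem eq_of_isPositiveWithE2Params {n : ℕ} {c : ℂ} {α β : Fin n → ℂ}
    {A Λ B : Matrix (Fin n) (Fin n) ℂ} {S T : Fock n →L[ℂ] Fock n}
    (hS : HasE2Params S c α β A Λ B) (hT : HasE2Params T c α β A Λ B) : S = T :=
  eq_of_genFun_eq fun u v => (hS.2.2 u v).trans (hT.2.2 u v).symm

/-! ### The real quadratic form of M(A,0). -/

/-- The pure-squeezing part of the real quadratic form: `Re (z̄ᵀ A z̄) = (x, y)ᵀ K (x, y)`. -/
def squeezeMatrix {n : ℕ} (A : Matrix (Fin n) (Fin n) ℂ) :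
    Matrix (Fin n ⊕ Fin n) (Fin n ⊕ Fin n) ℝ :=
  Matrix.fromBlocks (A.map Complex.re) (A.map Complex.im) (A.map Complex.im) (-A.map Complex.re)

/-- The point `x + i y` with real coordinates `(x, y)`. -/
def toComplex {n : ℕ} (p : Fin n ⊕ Fin n → ℝ) (i : Fin n) : ℂ :=
  p (Sum.inl i) + Complex.I * p (Sum.inr i)

/-- The real coordinates `(x, y)` of `x + i y`. -/
def toReal {n : ℕ} (z : Fin n → ℂ) : Fin n ⊕ Fin n → ℝ :=
  Sum.elim (fun i => (z i).re) (fun i => (z i).im)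

@[simp] theorem toReal_toComplex {n : ℕ} (p : Fin n ⊕ Fin n → ℝ) : toReal (toComplex p) = p := by
  ext i
  rcases i with i | i <;> simp [toComplex, toReal]

theorem bigM_zero {n : ℕ} (A : Matrix (Fin n) (Fin n) ℂ) : bigM A 0 = 1 - 2 • squeezeMatrix A := by
  simp [bigM, squeezeMatrix]

theorem squeezeMatrix_isSymm {n : ℕ} {A : Matrix (Fin n) (Fin n) ℂ} (hA : A.IsSymm) :
    (squeezeMatrix A).IsSymm := by
  have h1 : (A.map Complex.im)ᵀ = A.map Complex.im := hA.map _
  have h2 : (A.map Complex.re)ᵀ = A.map Complex.re := hA.map _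
  simp [Matrix.IsSymm, squeezeMatrix, Matrix.fromBlocks_transpose, h1, h2]

theorem bigM_isSymm {n : ℕ} {A : Matrix (Fin n) (Fin n) ℂ} (hA : A.IsSymm) :
    (bigM A 0).IsSymm := by
  rw [bigM_zero]
  exact Matrix.isSymm_one.sub ((squeezeMatrix_isSymm hA).smul 2)

/-- The matrix `K` acts as the antilinear map `z ↦ A z̄`. -/
theorem squeezeMatrix_mulVec {n : ℕ} (A : Matrix (Fin n) (Fin n) ℂ) (z : Fin n → ℂ) :
    squeezeMatrix A *ᵥ toReal z = toReal (A *ᵥ star z) := by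
  ext i
  rcases i with i | i
  · simp [squeezeMatrix, toReal, Matrix.mulVec, dotProduct, Finset.sum_add_distrib]
  · simp [squeezeMatrix, toReal, Matrix.mulVec, dotProduct, Finset.sum_add_distrib]
    ring

theorem toReal_dotProduct {n : ℕ} (z w : Fin n → ℂ) :
    toReal z ⬝ᵥ toReal w = (star z ⬝ᵥ w).re := by
  simp [toReal, dotProduct, Finset.sum_add_distrib]

theorem toReal_sub {n : ℕ} (z w : Fin n → ℂ) : toReal (z - w) = toReal z - toReal w := by
  ext i
  rcases i with i | i <;> simp [toReal]

theorem bigM_mulVec {n : ℕ} (A : Matrix (Fin n) (Fin n) ℂ) (z : Fin n → ℂ) :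
    bigM A 0 *ᵥ toReal z = toReal (z - (2 : ℝ) • A *ᵥ star z) := by
  rw [bigM_zero, Matrix.sub_mulVec, Matrix.one_mulVec, Matrix.smul_mulVec, squeezeMatrix_mulVec,
    toReal_sub]
  congr 1
  ext i
  rcases i with i | i <;> simp [toReal]

/-- The form of `M(A, 0)` is `‖z‖² - 2 Re (z̄ᵀ A z̄)`. -/
theorem dotProduct_bigM_mulVec {n : ℕ} (A : Matrix (Fin n) (Fin n) ℂ) (z : Fin n → ℂ) :
    toReal z ⬝ᵥ bigM A 0 *ᵥ toReal z =
      (star z ⬝ᵥ z).re - 2 * (star z ⬝ᵥ A *ᵥ star z).re := by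
  rw [bigM_mulVec, toReal_dotProduct, dotProduct_sub, dotProduct_smul]
  simp

/-- Square summability of `φ_A` forces `M(A, 0) ≥ 0`. -/
theorem bigM_posSemidef {n : ℕ} {A : Matrix (Fin n) (Fin n) ℂ} (hA : A.IsSymm)
    (h : Summable fun t : Fin n → ℕ => ‖phi A t‖ ^ 2) : (bigM A 0).PosSemidef := by
  refine Matrix.PosSemidef.of_dotProduct_mulVec_nonneg ?_ fun p => ?_
  · rw [Matrix.IsHermitian, Matrix.conjTranspose_eq_transpose_of_trivial]
    exact bigM_isSymm hA
  obtain ⟨z, rfl⟩ : ∃ z, p = toReal z := ⟨toComplex p, by simp⟩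
  rw [star_trivial, dotProduct_bigM_mulVec]
  -- Cauchy–Schwarz against |e(z)⟩ bounds exp(-form) uniformly in z; a negative value of the form
  -- would be scaled to -∞.
  have hexp : ∀ z : Fin n → ℂ, Real.exp (2 * (star z ⬝ᵥ A *ᵥ star z).re - (star z ⬝ᵥ z).re) ≤
      ‖phiVec A h‖ ^ 2 := by
    intro z
    have h1 := norm_inner_le_norm (𝕜 := ℂ) (expVec z) (phiVec A h)
    have h2 : ‖expVec z‖ ^ 2 = Real.exp (star z ⬝ᵥ z).re := by
      have := congrArg norm (inner_expVec z z)
      rwa [inner_self_eq_norm_sq_to_K, Complex.norm_exp, norm_pow, RCLike.norm_ofReal,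
        abs_norm] at this
    rw [inner_expVec_phiVec hA, Complex.norm_exp] at h1
    have h3 := pow_le_pow_left₀ (Real.exp_nonneg _) h1 2
    rw [mul_pow, h2, ← Real.exp_nat_mul] at h3
    rw [Real.exp_sub, div_le_iff₀ (Real.exp_pos _), mul_comm (_ ^ 2)]
    exact_mod_cast h3
  by_contra hneg
  set d := 2 * (star z ⬝ᵥ A *ᵥ star z).re - (star z ⬝ᵥ z).re with hd
  have hdpos : 0 < d := by rw [hd]; linarith [not_le.1 hneg]
  -- Replacing z by √N z multiplies the form by N, and N is chosen so that already Nd exceeds the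
  -- bound.
  obtain ⟨N, hN⟩ := exists_nat_gt (‖phiVec A h‖ ^ 2 / d)
  rw [div_lt_iff₀ hdpos] at hN
  have h1 := hexp ((√(N : ℝ) : ℂ) • z)
  have h2 : 2 * (star ((√(N : ℝ) : ℂ) • z) ⬝ᵥ A *ᵥ star ((√(N : ℝ) : ℂ) • z)).re -
      (star ((√(N : ℝ) : ℂ) • z) ⬝ᵥ ((√(N : ℝ) : ℂ) • z)).re = N * d := by
    have h3 : (√(N : ℝ) : ℂ) * (√(N : ℝ) : ℂ) = ((N : ℝ) : ℂ) := by
      rw [← Complex.ofReal_mul, Real.mul_self_sqrt (Nat.cast_nonneg _)]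
    simp only [star_smul, smul_dotProduct, dotProduct_smul, Matrix.mulVec_smul, smul_eq_mul,
      RCLike.star_def, Complex.conj_ofReal, ← mul_assoc, h3, Complex.re_ofReal_mul, hd]
    ring
  rw [h2] at h1
  linarith [Real.add_one_le_exp (N * d)]

/-! ### Gaussian integrals over ℝ²ⁿ. -/

open MeasureTheory Filter Topology

open scoped MatrixOrder Matrix.Norms.L2Operator in
/-- The Gaussian integral with a positive definite real form and a complex linear term. -/
theorem gaussian_integral {n : ℕ} {M : Matrix (Fin n ⊕ Fin n) (Fin n ⊕ Fin n) ℝ} (hM : M.PosDef)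
    (c : Fin n ⊕ Fin n → ℂ) :
    Integrable (fun p : Fin n ⊕ Fin n → ℝ =>
        Complex.exp (-((p ⬝ᵥ M *ᵥ p : ℝ) : ℂ) + ∑ i, c i * p i)) ∧
      ∫ p : Fin n ⊕ Fin n → ℝ, Complex.exp (-((p ⬝ᵥ M *ᵥ p : ℝ) : ℂ) + ∑ i, c i * p i) =
        ((Real.pi ^ n / √M.det : ℝ) : ℂ) *
          Complex.exp ((c ⬝ᵥ M⁻¹.map Complex.ofReal *ᵥ c) / 4) := by
  -- With M = BᵀB the substitution v = Bp reduces to the standard gaussian; its Jacobian is |det B|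
  -- = √det M.
  obtain ⟨B, rfl⟩ : ∃ B : Matrix (Fin n ⊕ Fin n) (Fin n ⊕ Fin n) ℝ, M = Bᵀ * B := by
    obtain ⟨B, hB⟩ := CStarAlgebra.nonneg_iff_eq_star_mul_self.1 hM.posSemidef.nonneg
    exact ⟨B, by rwa [Matrix.star_eq_conjTranspose,
      Matrix.conjTranspose_eq_transpose_of_trivial] at hB⟩
  have hdet : (Bᵀ * B).det = B.det ^ 2 := by rw [Matrix.det_mul, Matrix.det_transpose, sq]
  have hB : B.det ≠ 0 := by
    intro h
    have := hM.det_pos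
    simp [hdet, h] at this
  have hBu : IsUnit B.det := isUnit_iff_ne_zero.2 hB
  -- The linear term in the new variable: d·(Bp) = c·p, and Σ dᵢ² = cᵀM⁻¹c.
  set d : Fin n ⊕ Fin n → ℂ := c ᵥ* B⁻¹.map Complex.ofReal with hd
  let g : (Fin n ⊕ Fin n → ℝ) → ℂ := fun v =>
    Complex.exp (-1 * ∑ i, (v i : ℂ) ^ 2 + ∑ i, d i * v i)
  have hmap : ∀ p : Fin n ⊕ Fin n → ℝ, (fun i => ((B *ᵥ p) i : ℂ)) =
      B.map Complex.ofReal *ᵥ fun i => (p i : ℂ) := by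
    intro p
    ext i
    simp [Matrix.mulVec, dotProduct]
  have hinv : B⁻¹.map Complex.ofReal * B.map Complex.ofReal =
      (1 : Matrix (Fin n ⊕ Fin n) (Fin n ⊕ Fin n) ℂ) := by
    have := Matrix.map_mul (L := B⁻¹) (M := B) (f := Complex.ofRealHom)
    rw [Matrix.nonsing_inv_mul _ hBu] at this
    exact this.symm.trans (Matrix.map_one _ (by simp) (by simp))
  have hfg : ∀ p : Fin n ⊕ Fin n → ℝ,
      Complex.exp (-((p ⬝ᵥ (Bᵀ * B) *ᵥ p : ℝ) : ℂ) + ∑ i, c i * p i) = g (B *ᵥ p) := by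
    intro p
    have h1 : p ⬝ᵥ (Bᵀ * B) *ᵥ p = ∑ i, (B *ᵥ p) i ^ 2 := by
      rw [← Matrix.mulVec_mulVec, Matrix.dotProduct_mulVec, Matrix.vecMul_transpose]
      simp [dotProduct, sq]
    have h2 : ∑ i, d i * ((B *ᵥ p) i : ℂ) = ∑ i, c i * p i := by
      change d ⬝ᵥ (fun i => ((B *ᵥ p) i : ℂ)) = c ⬝ᵥ fun i => (p i : ℂ)
      rw [hmap, hd, Matrix.dotProduct_mulVec, Matrix.vecMul_vecMul, hinv, Matrix.vecMul_one]
    simp only [g, h2, h1]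
    push_cast
    ring_nf
  simp only [hfg]
  have hg : Integrable g := GaussianFourier.integrable_cexp_neg_mul_sum_add (by simp) d
  have hmeas : AEMeasurable (Matrix.toLin' B) (volume : Measure (Fin n ⊕ Fin n → ℝ)) :=
    (LinearMap.continuous_on_pi _).aemeasurable
  have hvol := Real.map_matrix_volume_pi_eq_smul_volume_pi hB
  constructor
  · have h1 : Integrable g (Measure.map (Matrix.toLin' B) volume) := by
      rw [hvol]
      exact hg.smul_measure ENNReal.ofReal_ne_top
    exact h1.comp_aemeasurable hmeas
  · have h1 : ∫ p : Fin n ⊕ Fin n → ℝ, g (B *ᵥ p) =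
        ∫ y, g y ∂(Measure.map (Matrix.toLin' B) volume) := by
      rw [integral_map hmeas]
      · rfl
      · rw [hvol]
        exact (hg.smul_measure ENNReal.ofReal_ne_top).aestronglyMeasurable
    rw [h1, hvol, integral_smul_measure, ENNReal.toReal_ofReal (abs_nonneg _),
      GaussianFourier.integral_cexp_neg_mul_sum_add (by simp) d, hdet, Real.sqrt_sq_eq_abs,
      abs_inv]
    have h2 : ((Fintype.card (Fin n ⊕ Fin n) : ℂ) / 2) = (n : ℂ) := by
      simp
    have h3 : ∑ i, d i ^ 2 = c ⬝ᵥ (Bᵀ * B)⁻¹.map Complex.ofReal *ᵥ c := by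
      have h4 : (Bᵀ * B)⁻¹.map Complex.ofReal =
          B⁻¹.map Complex.ofReal * (B⁻¹.map Complex.ofReal)ᵀ := by
        rw [Matrix.mul_inv_rev, ← Matrix.transpose_nonsing_inv]
        exact Matrix.map_mul (f := Complex.ofRealHom)
      rw [h4, ← Matrix.mulVec_mulVec, Matrix.dotProduct_mulVec, Matrix.mulVec_transpose, ← hd]
      simp [dotProduct, sq]
    rw [h2, h3, Complex.cpow_natCast]
    simp only [Complex.real_smul]
    push_cast
    ring_nf

/-! ### The Bargmann transform and the resolution of the identity. -/

/-- The Bargmann transform `exp (-|z|² / 2) ⟨e(z)|f⟩` in real coordinates. -/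
noncomputable def bargmann {n : ℕ} (f : Fock n) (p : Fin n ⊕ Fin n → ℝ) : ℂ :=
  (Real.exp (-(p ⬝ᵥ p) / 2) : ℂ) * ⟪expVec (toComplex p), f⟫_ℂ

theorem bargmann_expVec {n : ℕ} (w : Fin n → ℂ) (p : Fin n ⊕ Fin n → ℝ) :
    bargmann (expVec w) p = (Real.exp (-(p ⬝ᵥ p) / 2) : ℂ) *
      Complex.exp (star (toComplex p) ⬝ᵥ w) := by
  rw [bargmann, inner_expVec]

theorem continuous_bargmann_expVec {n : ℕ} (w : Fin n → ℂ) :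
    Continuous (bargmann (expVec w)) := by
  simp only [funext (bargmann_expVec w)]
  unfold toComplex dotProduct
  simp only [Pi.star_apply]
  fun_prop

/-- This brings the integrand to the shape of `gaussian_integral` with M = 1: for z = x + iy, the
term z̄·w + z·ū has coefficient w + ū at x and i(ū - w) at y. -/
theorem bargmann_expVec_mul {n : ℕ} (u w : Fin n → ℂ) (p : Fin n ⊕ Fin n → ℝ) :
    ⟪bargmann (expVec u) p, bargmann (expVec w) p⟫_ℂ =
      Complex.exp (-((p ⬝ᵥ (1 : Matrix (Fin n ⊕ Fin n) (Fin n ⊕ Fin n) ℝ) *ᵥ p : ℝ) : ℂ) +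
        ∑ i, Sum.elim (fun i => w i + conj (u i)) (fun i => Complex.I * (conj (u i) - w i)) i *
          p i) := by
  rw [bargmann_expVec, bargmann_expVec, RCLike.inner_apply, map_mul, Complex.conj_ofReal,
    ← Complex.exp_conj, Matrix.one_mulVec, Complex.ofReal_exp, mul_mul_mul_comm,
    ← Complex.exp_add, ← Complex.exp_add, ← Complex.exp_add]
  congr 1
  have h1 : ∑ i, Sum.elim (fun i => w i + conj (u i)) (fun i => Complex.I * (conj (u i) - w i)) i *
      (p i : ℂ) = star (toComplex p) ⬝ᵥ w + conj (star (toComplex p) ⬝ᵥ u) := by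
    simp only [dotProduct, Fintype.sum_sum_type, Sum.elim_inl, Sum.elim_inr, map_sum,
      ← Finset.sum_add_distrib]
    refine Finset.sum_congr rfl fun i _ => ?_
    simp [toComplex]
    ring
  rw [h1]
  push_cast
  ring

theorem integral_bargmann_expVec {n : ℕ} (u w : Fin n → ℂ) :
    Integrable (fun p => ⟪bargmann (expVec u) p, bargmann (expVec w) p⟫_ℂ) ∧
      ∫ p, ⟪bargmann (expVec u) p, bargmann (expVec w) p⟫_ℂ =
        (Real.pi ^ n : ℝ) * ⟪expVec u, expVec w⟫_ℂ := by
  have h := gaussian_integral (n := n) Matrix.PosDef.one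
    (Sum.elim (fun i => w i + conj (u i)) (fun i => Complex.I * (conj (u i) - w i)))
  simp only [← bargmann_expVec_mul] at h
  refine ⟨h.1, h.2.trans ?_⟩
  rw [inner_expVec]
  congr 2
  · simp
  · have h1 : (1 : Matrix (Fin n ⊕ Fin n) (Fin n ⊕ Fin n) ℝ)⁻¹.map Complex.ofReal = 1 := by
      rw [inv_one]
      exact Matrix.map_one _ (by simp) (by simp)
    rw [h1, Matrix.one_mulVec]
    simp only [dotProduct, Fintype.sum_sum_type, Sum.elim_inl, Sum.elim_inr, Pi.star_apply,
      RCLike.star_def]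
    rw [← Finset.sum_add_distrib, Finset.sum_div]
    refine Finset.sum_congr rfl fun i _ => ?_
    -- Modewise this is ((w + ū)² - (ū - w)²)/4 = ūw.
    linear_combination ((conj (u i) - w i) ^ 2 / 4) * Complex.I_mul_I

theorem memLp_bargmann_expVec {n : ℕ} (w : Fin n → ℂ) : MemLp (bargmann (expVec w)) 2 := by
  rw [memLp_two_iff_integrable_sq_norm (continuous_bargmann_expVec w).aestronglyMeasurable]
  refine (integral_bargmann_expVec w w).1.norm.congr (.of_forall fun p => ?_)
  simp [sq]

/-- The Bargmann transform on finite combinations of exponential vectors. -/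
noncomputable def bargmannSum (n : ℕ) :
    ((Fin n → ℂ) →₀ ℂ) →ₗ[ℂ] Lp ℂ 2 (volume : Measure (Fin n ⊕ Fin n → ℝ)) :=
  Finsupp.linearCombination ℂ fun w => (memLp_bargmann_expVec w).toLp _

theorem inner_bargmann_toLp {n : ℕ} (u w : Fin n → ℂ) :
    ⟪(memLp_bargmann_expVec u).toLp _, (memLp_bargmann_expVec w).toLp _⟫_ℂ =
      (Real.pi ^ n : ℝ) * ⟪expVec u, expVec w⟫_ℂ := by
  rw [L2.inner_def, ← (integral_bargmann_expVec u w).2]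
  refine integral_congr_ae ?_
  filter_upwards [(memLp_bargmann_expVec u).coeFn_toLp, (memLp_bargmann_expVec w).coeFn_toLp]
    with p h1 h2
  rw [h1, h2]

/-- The norm identity makes the transform extend continuously from finite combinations of
exponential vectors to the whole space. -/
theorem norm_bargmannSum (n : ℕ) (F : (Fin n → ℂ) →₀ ℂ) :
    ‖bargmannSum n F‖ = √(Real.pi ^ n) * ‖Finsupp.linearCombination ℂ expVec F‖ := by
  have h : ⟪bargmannSum n F, bargmannSum n F⟫_ℂ = (Real.pi ^ n : ℝ) *
      ⟪Finsupp.linearCombination ℂ expVec F, Finsupp.linearCombination ℂ expVec F⟫_ℂ := by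
    simp only [bargmannSum, Finsupp.linearCombination_apply, Finsupp.sum, sum_inner, inner_sum,
      Finset.mul_sum]
    refine Finset.sum_congr rfl fun z _ => Finset.sum_congr rfl fun w _ => ?_
    rw [inner_smul_left (r := F w), inner_smul_left (r := F w), inner_smul_right (r := F z),
      inner_smul_right (r := F z), inner_bargmann_toLp]
    ring
  rw [inner_self_eq_norm_sq_to_K, inner_self_eq_norm_sq_to_K] at h
  have h2 : ‖bargmannSum n F‖ ^ 2 =
      Real.pi ^ n * ‖Finsupp.linearCombination ℂ expVec F‖ ^ 2 :=
    Complex.ofReal_injective (by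
      rw [Complex.ofReal_mul, Complex.ofReal_pow, Complex.ofReal_pow ‖_‖]
      exact h)
  have h3 : (0 : ℝ) ≤ Real.pi ^ n := by positivity
  refine (sq_eq_sq₀ (norm_nonneg _) (by positivity)).1 ?_
  rw [h2, mul_pow, Real.sq_sqrt h3]

theorem denseRange_linearCombination_expVec (n : ℕ) :
    DenseRange (Finsupp.linearCombination ℂ (expVec (n := n))) := by
  have := Submodule.dense_iff_topologicalClosure_eq_top.2 (dense_span_expVec n)
  rwa [← Finsupp.range_linearCombination] at this

/-- The Bargmann transform as a bounded operator into `L²`. -/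
noncomputable def bargmannL (n : ℕ) :
    Fock n →L[ℂ] Lp ℂ 2 (volume : Measure (Fin n ⊕ Fin n → ℝ)) :=
  (bargmannSum n).extendOfNorm (Finsupp.linearCombination ℂ expVec)

theorem bargmannL_linearCombination {n : ℕ} (F : (Fin n → ℂ) →₀ ℂ) :
    bargmannL n (Finsupp.linearCombination ℂ expVec F) = bargmannSum n F :=
  LinearMap.extendOfNorm_eq (denseRange_linearCombination_expVec n)
    ⟨_, fun F => (norm_bargmannSum n F).le⟩ F

theorem bargmannL_expVec {n : ℕ} (w : Fin n → ℂ) :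
    bargmannL n (expVec w) = (memLp_bargmann_expVec w).toLp _ := by
  simpa [bargmannSum] using bargmannL_linearCombination (Finsupp.single w 1)

theorem inner_bargmannL {n : ℕ} (f g : Fock n) :
    ⟪bargmannL n f, bargmannL n g⟫_ℂ = (Real.pi ^ n : ℝ) * ⟪f, g⟫_ℂ := by
  have h1 : ∀ u, innerSL ℂ (bargmannL n (expVec u)) ∘L bargmannL n =
      ((Real.pi ^ n : ℝ) : ℂ) • innerSL ℂ (expVec u) := by
    intro u
    refine ext_of_expVec fun w => ?_
    simp only [ContinuousLinearMap.comp_apply, innerSL_apply_apply, smul_apply,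
      bargmannL_expVec, inner_bargmann_toLp, smul_eq_mul]
  -- The identity is first extended in the right argument; conjugation exchanges the arguments, and
  -- density is used once more.
  have h2 : innerSL ℂ (bargmannL n g) ∘L bargmannL n =
      ((Real.pi ^ n : ℝ) : ℂ) • innerSL ℂ g := by
    refine ext_of_expVec fun u => ?_
    have h3 := congrArg conj (DFunLike.congr_fun (h1 u) g)
    simpa only [ContinuousLinearMap.comp_apply, innerSL_apply_apply,
      smul_apply, smul_eq_mul, map_mul, Complex.conj_ofReal,
      inner_conj_symm] using h3
  have h3 := congrArg conj (DFunLike.congr_fun h2 f)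
  simpa only [ContinuousLinearMap.comp_apply, innerSL_apply_apply,
      smul_apply, smul_eq_mul, map_mul, Complex.conj_ofReal,
      inner_conj_symm] using h3

theorem bargmannL_coeFn {n : ℕ} (f : Fock n) : bargmannL n f =ᵐ[volume] bargmann f := by
  have hcomb : ∀ F : (Fin n → ℂ) →₀ ℂ,
      bargmannL n (Finsupp.linearCombination ℂ expVec F) =ᵐ[volume]
        bargmann (Finsupp.linearCombination ℂ expVec F) := by
    intro F
    induction F using Finsupp.induction_linear with
    | zero =>
      rw [map_zero, map_zero]
      filter_upwards [Lp.coeFn_zero ℂ 2 (volume : Measure (Fin n ⊕ Fin n → ℝ))] with p hp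
      rw [hp]
      simp [bargmann]
    | add F G hF hG =>
      rw [map_add, map_add]
      filter_upwards [hF, hG, Lp.coeFn_add (bargmannL n (Finsupp.linearCombination ℂ expVec F))
        (bargmannL n (Finsupp.linearCombination ℂ expVec G))] with p h1 h2 h3
      rw [h3, Pi.add_apply, h1, h2, bargmann, bargmann, bargmann, inner_add_right, mul_add]
    | single w a =>
      rw [Finsupp.linearCombination_single, map_smul, bargmannL_expVec]
      filter_upwards [(memLp_bargmann_expVec w).coeFn_toLp,
        Lp.coeFn_smul a ((memLp_bargmann_expVec w).toLp _)] with p h1 h2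
      rw [h2, Pi.smul_apply, h1, bargmann, bargmann, inner_smul_right, smul_eq_mul]
      ring
  obtain ⟨s, hs, hsf⟩ := mem_closure_iff_seq_limit.1
    (denseRange_linearCombination_expVec n f)
  choose F hF using hs
  have h1 := ((bargmannL n).continuous.tendsto f).comp hsf
  -- L² convergence gives almost everywhere convergence along a subsequence, while the pointwise
  -- formula is continuous in f at each p; the limits therefore agree.
  obtain ⟨ns, hns, hae⟩ :=
    (tendstoInMeasure_of_tendsto_Lp h1).exists_seq_tendsto_ae
  have h2 : ∀ᵐ p ∂(volume : Measure (Fin n ⊕ Fin n → ℝ)), ∀ m,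
      bargmannL n (s m) p = bargmann (s m) p := by
    rw [ae_all_iff]
    intro m
    rw [← hF]
    exact hcomb (F m)
  filter_upwards [hae, h2] with p h3 h4
  refine tendsto_nhds_unique h3 ?_
  simp only [Function.comp_apply, h4]
  have h5 : Continuous fun f : Fock n => bargmann f p := by
    unfold bargmann
    fun_prop
  exact (h5.tendsto f).comp (hsf.comp hns.tendsto_atTop)

/-- The resolution of the identity by coherent states. -/
theorem integral_bargmann {n : ℕ} (f g : Fock n) :
    Integrable (fun p => ⟪bargmann f p, bargmann g p⟫_ℂ) ∧
      ∫ p, ⟪bargmann f p, bargmann g p⟫_ℂ = (Real.pi ^ n : ℝ) * ⟪f, g⟫_ℂ := by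
  have h : (fun p => ⟪bargmannL n f p, bargmannL n g p⟫_ℂ) =ᵐ[volume]
      fun p => ⟪bargmann f p, bargmann g p⟫_ℂ := by
    filter_upwards [bargmannL_coeFn f, bargmannL_coeFn g] with p h1 h2
    rw [h1, h2]
  refine ⟨(L2.integrable_inner _ _).congr h, ?_⟩
  rw [← integral_congr_ae h, ← L2.inner_def, inner_bargmannL]

/-! ### Positive definiteness of M(A,0) and the norm of Σ φ_A(t)|t⟩. -/

theorem gaussian_integral_real {n : ℕ} {M : Matrix (Fin n ⊕ Fin n) (Fin n ⊕ Fin n) ℝ}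
    (hM : M.PosDef) :
    Integrable (fun p : Fin n ⊕ Fin n → ℝ => Real.exp (-(p ⬝ᵥ M *ᵥ p))) ∧
      ∫ p : Fin n ⊕ Fin n → ℝ, Real.exp (-(p ⬝ᵥ M *ᵥ p)) = Real.pi ^ n / √M.det := by
  obtain ⟨h1, h2⟩ := gaussian_integral hM 0
  have h3 : ∀ p : Fin n ⊕ Fin n → ℝ,
      Complex.exp (-((p ⬝ᵥ M *ᵥ p : ℝ) : ℂ) + ∑ i, (0 : Fin n ⊕ Fin n → ℂ) i * p i) =
        ((Real.exp (-(p ⬝ᵥ M *ᵥ p)) : ℝ) : ℂ) := by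
    intro p
    simp
  simp only [h3] at h1 h2
  refine ⟨h1.re, ?_⟩
  rw [integral_complex_ofReal] at h2
  refine Complex.ofReal_injective (h2.trans ?_)
  simp

/-- The link between φ_A and M(A,0): the squared modulus of exp(-|z|²/2 + z̄ᵀAz̄) is exp(-|z|² + 2
Re z̄ᵀAz̄). -/
theorem inner_bargmann_phiVec {n : ℕ} {A : Matrix (Fin n) (Fin n) ℂ} (hA : A.IsSymm)
    (h : Summable fun t : Fin n → ℕ => ‖phi A t‖ ^ 2) (p : Fin n ⊕ Fin n → ℝ) :
    ⟪bargmann (phiVec A h) p, bargmann (phiVec A h) p⟫_ℂ =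
      Complex.exp (-((p ⬝ᵥ bigM A 0 *ᵥ p : ℝ) : ℂ)) := by
  have h1 := dotProduct_bigM_mulVec A (toComplex p)
  rw [← toReal_dotProduct, toReal_toComplex] at h1
  rw [bargmann, inner_expVec_phiVec hA, RCLike.inner_apply, map_mul, Complex.conj_ofReal,
    ← Complex.exp_conj, Complex.ofReal_exp, ← Complex.exp_add, ← Complex.exp_add,
    ← Complex.exp_add, h1]
  congr 1
  have h2 := Complex.add_conj (star (toComplex p) ⬝ᵥ A *ᵥ star (toComplex p))
  push_cast at h2 ⊢
  linear_combination h2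

theorem integral_exp_neg_bigM {n : ℕ} {A : Matrix (Fin n) (Fin n) ℂ} (hA : A.IsSymm)
    (h : Summable fun t : Fin n → ℕ => ‖phi A t‖ ^ 2) :
    Integrable (fun p : Fin n ⊕ Fin n → ℝ => Real.exp (-(p ⬝ᵥ bigM A 0 *ᵥ p))) ∧
      ∫ p : Fin n ⊕ Fin n → ℝ, Real.exp (-(p ⬝ᵥ bigM A 0 *ᵥ p)) =
        Real.pi ^ n * ‖phiVec A h‖ ^ 2 := by
  obtain ⟨h1, h2⟩ := integral_bargmann (phiVec A h) (phiVec A h)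
  simp only [inner_bargmann_phiVec hA h, ← Complex.ofReal_neg, ← Complex.ofReal_exp] at h1 h2
  refine ⟨h1.re, ?_⟩
  rw [integral_complex_ofReal, inner_self_eq_norm_sq_to_K] at h2
  refine Complex.ofReal_injective (h2.trans ?_)
  rw [Complex.ofReal_mul, Complex.ofReal_pow ‖_‖]
  rfl

/-- Square summability of `φ_A` forces `M(A, 0)` to be positive definite. -/
theorem bigM_posDef {n : ℕ} {A : Matrix (Fin n) (Fin n) ℂ} (hA : A.IsSymm)
    (h : Summable fun t : Fin n → ℕ => ‖phi A t‖ ^ 2) : (bigM A 0).PosDef := by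
  have hpsd := bigM_posSemidef hA h
  rw [hpsd.posDef_iff_det_ne_zero]
  obtain ⟨hint, hval⟩ := integral_exp_neg_bigM hA h
  have hpi : 0 < Real.pi ^ n := by positivity
  -- M + ε is positive definite and its gaussian integral πⁿ/√det(M + ε) is at most that of M, which
  -- is πⁿ‖φ‖². Letting ε → 0 in the resulting bound excludes det M = 0.
  have key : ∀ ε : ℝ, 0 < ε →
      1 ≤ ‖phiVec A h‖ ^ 2 * √(bigM A 0 + ε • (1 : Matrix (Fin n ⊕ Fin n) _ ℝ)).det := by
    intro ε hε
    have hpd : (bigM A 0 + ε • (1 : Matrix (Fin n ⊕ Fin n) (Fin n ⊕ Fin n) ℝ)).PosDef :=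
      Matrix.PosDef.posSemidef_add hpsd (Matrix.PosDef.one.smul hε)
    obtain ⟨h1, h2⟩ := gaussian_integral_real hpd
    have h3 := integral_mono h1 hint fun p => by
      refine Real.exp_le_exp.2 (neg_le_neg ?_)
      rw [Matrix.add_mulVec, dotProduct_add, Matrix.smul_mulVec, Matrix.one_mulVec,
        dotProduct_smul, smul_eq_mul]
      have : 0 ≤ p ⬝ᵥ p := Finset.sum_nonneg fun i _ => mul_self_nonneg _
      have := mul_nonneg hε.le this
      linarith
    rw [h2, hval, div_le_iff₀ (Real.sqrt_pos.2 hpd.det_pos), mul_assoc] at h3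
    exact le_of_mul_le_mul_left (by simpa using h3) hpi
  have hcont : Continuous fun ε : ℝ => ‖phiVec A h‖ ^ 2 *
      √(bigM A 0 + ε • (1 : Matrix (Fin n ⊕ Fin n) (Fin n ⊕ Fin n) ℝ)).det :=
    continuous_const.mul (Real.continuous_sqrt.comp
      (Continuous.matrix_det (continuous_const.add (continuous_id.smul continuous_const))))
  have hlim := ge_of_tendsto ((hcont.tendsto 0).mono_left nhdsWithin_le_nhds)
    (eventually_nhdsWithin_of_forall (s := Set.Ioi 0) key)
  intro h0
  simp [h0] at hlim
  linarith

/-- The integral of exp(-pᵀMp) is evaluated twice: by the resolution of the identity and by the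
gaussian formula. -/
theorem norm_sq_phiVec {n : ℕ} {A : Matrix (Fin n) (Fin n) ℂ} (hA : A.IsSymm)
    (h : Summable fun t : Fin n → ℕ => ‖phi A t‖ ^ 2) :
    ‖phiVec A h‖ ^ 2 = 1 / cConst A 0 := by
  have h1 := (integral_exp_neg_bigM hA h).2
  rw [(gaussian_integral_real (bigM_posDef hA h)).2] at h1
  have hpi : Real.pi ^ n ≠ 0 := by positivity
  rw [cConst]
  refine mul_left_cancel₀ hpi ?_
  rw [← h1]
  ring

theorem cConst_pos {n : ℕ} {A : Matrix (Fin n) (Fin n) ℂ} (hA : A.IsSymm)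
    (h : Summable fun t : Fin n → ℕ => ‖phi A t‖ ^ 2) : 0 < cConst A 0 :=
  Real.sqrt_pos.2 (bigM_posDef hA h).det_pos

/-! ### Weyl operators and the characteristic function. -/

theorem coherent_eq {n : ℕ} (z : Fin n → ℂ) :
    coherent z = Complex.exp (-(star z ⬝ᵥ z) / 2) • expVec z := by
  rw [coherent, Complex.ofReal_exp]
  congr 2
  push_cast
  simp [dotProduct, Complex.conj_mul']

/-- The action of the Weyl operator on exponential vectors. -/
theorem weyl_expVec {n : ℕ} (w b : Fin n → ℂ) :
    weyl w (expVec b) =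
      Complex.exp (-(star w ⬝ᵥ b) - (star w ⬝ᵥ w) / 2) • expVec (w + b) := by
  have him : Complex.I * ((star w ⬝ᵥ b).im : ℂ) = (star w ⬝ᵥ b - star b ⬝ᵥ w) / 2 := by
    have h : star b ⬝ᵥ w = conj (star w ⬝ᵥ b) := by
      simp [dotProduct, map_sum, mul_comm]
    rw [h]
    apply Complex.ext <;> simp
  have h1 := weyl_coherent w b
  rw [coherent_eq, coherent_eq, map_smul, smul_smul, ← Complex.exp_add] at h1
  have h2 := congrArg (Complex.exp ((star b ⬝ᵥ b) / 2) • ·) h1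
  simp only [smul_smul, ← Complex.exp_add] at h2
  rw [show (star b ⬝ᵥ b) / 2 + -(star b ⬝ᵥ b) / 2 = 0 by ring, Complex.exp_zero, one_smul] at h2
  rw [h2]
  congr 2
  rw [neg_mul, him]
  simp only [star_add, add_dotProduct, dotProduct_add]
  ring

/-- Up to a scalar the adjoint of W(w) sends |e(z)⟩ to |e(z - w)⟩; by density it suffices to test f
on exponential vectors. Hence W(w) acts on Bargmann transforms by a shift. -/
theorem inner_expVec_weyl {n : ℕ} (z w : Fin n → ℂ) (f : Fock n) :
    ⟪expVec z, weyl w f⟫_ℂ =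
      Complex.exp (star z ⬝ᵥ w - (star w ⬝ᵥ w) / 2) * ⟪expVec (z - w), f⟫_ℂ := by
  have h : innerSL ℂ (expVec z) ∘L weyl w =
      Complex.exp (star z ⬝ᵥ w - (star w ⬝ᵥ w) / 2) • innerSL ℂ (expVec (z - w)) := by
    refine ext_of_expVec fun b => ?_
    simp only [ContinuousLinearMap.comp_apply, innerSL_apply_apply, smul_apply, weyl_expVec,
      inner_smul_right, inner_expVec, smul_eq_mul, ← Complex.exp_add]
    congr 1
    simp only [star_sub, sub_dotProduct, dotProduct_add]
    ring
  exact DFunLike.congr_fun h f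

/-- The diagonal terms ⟨k|ψ⟩⟨ψ|Tk⟩ are those of the Parseval series for ⟨T*ψ|ψ⟩. -/
theorem hasTrace_ketbra_comp {n : ℕ} (ψ : Fock n) (T : Fock n →L[ℂ] Fock n) :
    HasTrace (ketbra ψ ∘L T) ⟪ψ, T ψ⟫_ℂ := by
  rw [← ContinuousLinearMap.adjoint_inner_left]
  refine (lp.hasSum_inner (𝕜 := ℂ) (ContinuousLinearMap.adjoint T ψ) ψ).congr_fun fun k => ?_
  have h1 : ∀ f : Fock n, ⟪ket k, f⟫_ℂ = f k := by
    intro f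
    rw [ket, lp.inner_single_left]
    simp
  rw [ContinuousLinearMap.comp_apply, ketbra, InnerProductSpace.rankOne_apply, inner_smul_right,
    h1, ← ContinuousLinearMap.adjoint_inner_left, ← inner_conj_symm, h1, RCLike.inner_apply,
    mul_comm]

/-- The real covariance form of the pure state attached to `A`. -/
noncomputable def pureCovariance {n : ℕ} (A : Matrix (Fin n) (Fin n) ℂ) :
    Matrix (Fin n ⊕ Fin n) (Fin n ⊕ Fin n) ℝ :=
  (1 / 4 : ℝ) • (bigM A 0 + (Matrix.fromBlocks 0 1 (-1) 0 * bigM A 0)ᵀ * (bigM A 0)⁻¹ *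
    (Matrix.fromBlocks 0 1 (-1) 0 * bigM A 0))

theorem pureCovariance_isSymm {n : ℕ} {A : Matrix (Fin n) (Fin n) ℂ} (hA : A.IsSymm) :
    (pureCovariance A).IsSymm := by
  have h1 : (bigM A 0)ᵀ = bigM A 0 := bigM_isSymm hA
  simp only [pureCovariance, Matrix.IsSymm, Matrix.transpose_smul, Matrix.transpose_add,
    Matrix.transpose_mul, Matrix.transpose_transpose, Matrix.transpose_nonsing_inv, h1,
    Matrix.mul_assoc]

/-- A real symmetric form evaluated at a complex vector. -/
theorem dotProduct_map_mulVec_add_I {ι : Type*} [Fintype ι] {Q : Matrix ι ι ℝ} (hQ : Q.IsSymm)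
    (a b : ι → ℝ) :
    (fun i => (a i : ℂ) + Complex.I * b i) ⬝ᵥ
        Q.map Complex.ofReal *ᵥ (fun i => (a i : ℂ) + Complex.I * b i) =
      ((a ⬝ᵥ Q *ᵥ a - b ⬝ᵥ Q *ᵥ b : ℝ) : ℂ) + 2 * Complex.I * ((b ⬝ᵥ Q *ᵥ a : ℝ) : ℂ) := by
  have h0 : (fun i => (a i : ℂ) + Complex.I * b i) =
      (Complex.ofRealHom ∘ a) + Complex.I • (Complex.ofRealHom ∘ b) := by
    ext i; simp
  have h1 : ∀ x y : ι → ℝ, (Complex.ofRealHom ∘ x) ⬝ᵥ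
      Q.map Complex.ofReal *ᵥ (Complex.ofRealHom ∘ y) = ((x ⬝ᵥ Q *ᵥ y : ℝ) : ℂ) := by
    intro x y
    simp [dotProduct, Matrix.mulVec]
  have h2 : a ⬝ᵥ Q *ᵥ b = b ⬝ᵥ Q *ᵥ a := by
    rw [Matrix.dotProduct_mulVec, ← Matrix.mulVec_transpose, hQ.eq, dotProduct_comm]
  rw [h0]
  simp only [Matrix.mulVec_add, Matrix.mulVec_smul, dotProduct_add, add_dotProduct,
    dotProduct_smul, smul_dotProduct, h1, h2, smul_eq_mul]
  push_cast
  linear_combination ((b ⬝ᵥ Q *ᵥ b : ℝ) : ℂ) * Complex.I_mul_I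

/-- The characteristic function of the unnormalized vector with coefficients `φ_A(t)`. -/
theorem inner_phiVec_weyl {n : ℕ} {A : Matrix (Fin n) (Fin n) ℂ} (hA : A.IsSymm)
    (h : Summable fun t : Fin n → ℕ => ‖phi A t‖ ^ 2) (w : Fin n → ℂ) :
    ⟪phiVec A h, weyl w (phiVec A h)⟫_ℂ = ((1 / cConst A 0 : ℝ) : ℂ) *
      Complex.exp (-((toReal w ⬝ᵥ pureCovariance A *ᵥ toReal w : ℝ) : ℂ)) := by
  -- Expanding (z̄ - w̄)ᵀA(z̄ - w̄), the Weyl operator multiplies the transform of φ by exp(κ +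
  -- z̄·β). Conveniently, β has real coordinates Mw.
  set β : Fin n → ℂ := w - (2 : ℝ) • A *ᵥ star w with hβ
  set κ : ℂ := star w ⬝ᵥ A *ᵥ star w - (star w ⬝ᵥ w) / 2 with hκ
  set m : Fin n ⊕ Fin n → ℝ := toReal β with hm
  -- In real coordinates z̄·β has coefficient vector m + i m' with m' = Jm, J = [0, 1; -1, 0]; this
  -- is the source of J in `pureCovariance`.
  set m' : Fin n ⊕ Fin n → ℝ :=
    (Matrix.fromBlocks 0 1 (-1) 0 : Matrix (Fin n ⊕ Fin n) (Fin n ⊕ Fin n) ℝ) *ᵥ m with hm'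
  have hMw : bigM A 0 *ᵥ toReal w = m := bigM_mulVec A w
  have hpd := bigM_posDef hA h
  have hunit : IsUnit (bigM A 0).det := isUnit_iff_ne_zero.2 hpd.det_pos.ne'
  have hinv : (bigM A 0)⁻¹ *ᵥ m = toReal w := by
    rw [← hMw, Matrix.mulVec_mulVec, Matrix.nonsing_inv_mul _ hunit, Matrix.one_mulVec]
  have hinvsymm : (bigM A 0)⁻¹.IsSymm := by
    rw [Matrix.IsSymm, Matrix.transpose_nonsing_inv, (bigM_isSymm hA).eq]
  have hm'1 : ∀ i, m' (Sum.inl i) = (β i).im := by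
    intro i
    simp [hm', hm, toReal, Matrix.fromBlocks_mulVec, Function.comp_def]
  have hm'2 : ∀ i, m' (Sum.inr i) = -(β i).re := by
    intro i
    simp [hm', hm, toReal, Matrix.fromBlocks_mulVec, Function.comp_def, Matrix.neg_mulVec]
  have hlin : ∀ p : Fin n ⊕ Fin n → ℝ,
      ∑ i, ((m i : ℂ) + Complex.I * m' i) * p i = star (toComplex p) ⬝ᵥ β := by
    intro p
    simp only [Fintype.sum_sum_type, dotProduct, ← Finset.sum_add_distrib]
    refine Finset.sum_congr rfl fun i _ => ?_
    rw [hm'1, hm'2]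
    apply Complex.ext
    · simp [hm, toReal, toComplex]; ring
    · simp [hm, toReal, toComplex]; ring
  have hb : ∀ p : Fin n ⊕ Fin n → ℝ,
      ⟪bargmann (phiVec A h) p, bargmann (weyl w (phiVec A h)) p⟫_ℂ =
        Complex.exp κ * Complex.exp (-((p ⬝ᵥ bigM A 0 *ᵥ p : ℝ) : ℂ) +
          ∑ i, ((m i : ℂ) + Complex.I * m' i) * p i) := by
    intro p
    have h1 : bargmann (weyl w (phiVec A h)) p =
        Complex.exp (κ + star (toComplex p) ⬝ᵥ β) * bargmann (phiVec A h) p := by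
      have h2 : star w ⬝ᵥ A *ᵥ star (toComplex p) = star (toComplex p) ⬝ᵥ A *ᵥ star w := by
        rw [Matrix.dotProduct_mulVec, ← Matrix.mulVec_transpose, hA.eq, dotProduct_comm]
      rw [bargmann, bargmann, inner_expVec_weyl, inner_expVec_phiVec hA, inner_expVec_phiVec hA,
        mul_left_comm (Complex.exp _), ← Complex.exp_add, ← Complex.exp_add]
      congr 2
      rw [hβ, hκ]
      simp only [star_sub, sub_dotProduct, dotProduct_sub, Matrix.mulVec_sub, dotProduct_smul, h2,
        Complex.real_smul]
      push_cast
      ring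
    rw [h1, ← smul_eq_mul, inner_smul_right, inner_bargmann_phiVec hA h, hlin, Complex.exp_add,
      Complex.exp_add]
    ring
  have hI := (integral_bargmann (phiVec A h) (weyl w (phiVec A h))).2
  simp only [hb] at hI
  rw [integral_const_mul, (gaussian_integral hpd _).2, dotProduct_map_mulVec_add_I hinvsymm,
    hinv] at hI
  have hpi : ((Real.pi ^ n : ℝ) : ℂ) ≠ 0 := by
    exact_mod_cast (by positivity : Real.pi ^ n ≠ 0)
  refine mul_left_cancel₀ hpi (hI.symm.trans ?_)
  have hform : toReal w ⬝ᵥ pureCovariance A *ᵥ toReal w =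
      (m ⬝ᵥ toReal w + m' ⬝ᵥ (bigM A 0)⁻¹ *ᵥ m') / 4 := by
    rw [pureCovariance, Matrix.smul_mulVec, Matrix.add_mulVec, dotProduct_smul, dotProduct_add,
      ← Matrix.mulVec_mulVec, ← Matrix.mulVec_mulVec, ← Matrix.mulVec_mulVec, hMw, ← hm',
      Matrix.dotProduct_mulVec _ (_ᵀ), Matrix.vecMul_transpose, ← Matrix.mulVec_mulVec, hMw, ← hm',
      dotProduct_comm m, smul_eq_mul]
    ring
  have hre : m ⬝ᵥ toReal w = (star w ⬝ᵥ w).re - 2 * (star w ⬝ᵥ A *ᵥ star w).re := by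
    rw [← dotProduct_bigM_mulVec, hMw, dotProduct_comm]
  have hww : ((star w ⬝ᵥ w).re : ℂ) = star w ⬝ᵥ w := by
    apply Complex.ext
    · simp
    · simp only [Complex.ofReal_im, dotProduct, Complex.im_sum]
      refine (Finset.sum_eq_zero fun i _ => ?_).symm
      simp; ring
  have him : m' ⬝ᵥ toReal w = -2 * (star w ⬝ᵥ A *ᵥ star w).im := by
    have h1 : m' ⬝ᵥ toReal w = (star w ⬝ᵥ β).im := by
      simp only [dotProduct, Fintype.sum_sum_type, Complex.im_sum, ← Finset.sum_add_distrib]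
      refine Finset.sum_congr rfl fun i _ => ?_
      rw [hm'1, hm'2]
      simp [toReal]; ring
    rw [h1, hβ, dotProduct_sub, dotProduct_smul, ← hww]
    simp
  -- The real part of κ is -m·w/2, which with the gaussian exponent leaves -(m·w + m'ᵀM⁻¹m')/4. The
  -- imaginary parts cancel because m'·w = -2 Im(w̄ᵀAw̄), so the mean is zero.
  have hexp : κ + (((m ⬝ᵥ toReal w - m' ⬝ᵥ (bigM A 0)⁻¹ *ᵥ m' : ℝ) : ℂ) +
      2 * Complex.I * ((m' ⬝ᵥ toReal w : ℝ) : ℂ)) / 4 =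
      -((toReal w ⬝ᵥ pureCovariance A *ᵥ toReal w : ℝ) : ℂ) := by
    have h1 := Complex.re_add_im (star w ⬝ᵥ A *ᵥ star w)
    rw [hform, hκ, him]
    rw [hre]
    push_cast
    rw [hww]
    linear_combination -h1
  rw [← hexp, Complex.exp_add, cConst]
  push_cast
  ring

theorem norm_normalized_phiVec {n : ℕ} {A : Matrix (Fin n) (Fin n) ℂ} (hA : A.IsSymm)
    (h : Summable fun t : Fin n → ℕ => ‖phi A t‖ ^ 2) :
    ‖(√(cConst A 0) : ℂ) • phiVec A h‖ = 1 := by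
  have h1 := cConst_pos hA h
  rw [← sq_eq_sq₀ (norm_nonneg _) zero_le_one, norm_smul, mul_pow, norm_sq_phiVec hA,
    Complex.norm_real, Real.norm_of_nonneg (Real.sqrt_nonneg _), Real.sq_sqrt h1.le]
  field_simp

theorem isMeanZeroPureGaussian_normalized_phiVec {n : ℕ} {A : Matrix (Fin n) (Fin n) ℂ}
    (hA : A.IsSymm) (h : Summable fun t : Fin n → ℕ => ‖phi A t‖ ^ 2) :
    IsMeanZeroPureGaussian ((√(cConst A 0) : ℂ) • phiVec A h) := by
  have hc := cConst_pos hA h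
  have hn := norm_normalized_phiVec hA h
  refine ⟨hn, pureCovariance A, ⟨isPositive_ketbra _, ?_⟩, pureCovariance_isSymm hA, fun z => ?_⟩
  · have h1 := hasTrace_ketbra_comp ((√(cConst A 0) : ℂ) • phiVec A h)
      (ContinuousLinearMap.id ℂ (Fock n))
    rw [ContinuousLinearMap.comp_id, ContinuousLinearMap.id_apply, inner_self_eq_norm_sq_to_K,
      hn] at h1
    simpa using h1
  · convert hasTrace_ketbra_comp ((√(cConst A 0) : ℂ) • phiVec A h) (weyl z) using 1
    have h2 : (√(cConst A 0) : ℂ) * (√(cConst A 0) : ℂ) = cConst A 0 := by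
      rw [← Complex.ofReal_mul, Real.mul_self_sqrt hc.le]
    rw [map_smul, inner_smul_left, inner_smul_right, inner_phiVec_weyl hA h, Complex.conj_ofReal,
      ← mul_assoc, h2, ← mul_assoc, ← Complex.ofReal_mul, mul_one_div_cancel hc.ne']
    simp [toReal]

end BosonFock

/-! ### The proposition. -/

theorem mainTheorem7 (n : ℕ) (c : ℝ) (hc : 0 < c) (A : Matrix (Fin n) (Fin n) ℂ) (hA : A.IsSymm) :
    ((∃ Z : Fock n →L[ℂ] Fock n, IsPositiveWithE2Params Z c 0 A 0) ↔
      Summable fun t : Fin n → ℕ => ‖phi A t‖ ^ 2) ∧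
    ((Summable fun t : Fin n → ℕ => ‖phi A t‖ ^ 2) →
      (∃ ψ : Fock n, HasSum (fun t => ((√c : ℂ) * phi A t) • ket t) ψ ∧
        ∀ Z : Fock n →L[ℂ] Fock n, IsPositiveWithE2Params Z c 0 A 0 → Z = ketbra ψ) ∧
      (bigM A 0).PosSemidef ∧
      ∃ ψA : Fock n, HasSum (fun t => ((√(cConst A 0) : ℂ) * phi A t) • ket t) ψA ∧
        IsMeanZeroPureGaussian ψA ∧ IsPositiveWithE2Params (ketbra ψA) (cConst A 0) 0 A 0) := by
  refine ⟨⟨fun ⟨Z, hZ⟩ => summable_phi_of_isPositiveWithE2Params hc hA hZ, fun h =>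
    ⟨_, isPositiveWithE2Params_ketbra hA h hc.le⟩⟩, fun h => ⟨⟨_, hasSum_phiVec A h _, fun Z hZ =>
    eq_of_isPositiveWithE2Params hZ.2 (isPositiveWithE2Params_ketbra hA h hc.le).2⟩,
    bigM_posSemidef hA h, _, hasSum_phiVec A h _, isMeanZeroPureGaussian_normalized_phiVec hA h,
    isPositiveWithE2Params_ketbra hA h (cConst_pos hA h).le⟩⟩
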